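/- **Theorem 3.1.** Let $1<p\le 2$, $K\ge 1$ and $0<\tau_1<\dots<\tau_K<1$. For $\tau\in(0,1)$ put $$\eta_{\tau,p}(s)=|\tau-I(s<0)|\,|s|^p,\quad \varphi_{\tau,p}(s)=p|\tau-I(s<0)|\,|s|^{p-1}\operatorname{sign}(s),\quad \psi_{\tau,p}(s)=p(p-1)|\tau-I(s<0)|\,|s|^{p-2}.$$ Let $y_t=\mathbf x_t'\boldsymbol\beta^*+\varepsilon_t$, $t=1,2,\dots$, where $(\mathbf x_t)$ is a fixed sequence in $\mathbb R^m$, $\boldsymbol\beta^*\in\mathbb R^m$, and the $\varepsilon_t$ are i.i.d. copies of a real random variable $\varepsilon$. Let $b^*_{\tau_k}$ be the $\tau_k$-th $L^p$-quantile of $\varepsilon$, i.e. the minimiser of $c\mapsto E[\eta_{\tau_k,p}(\varepsilon-c)-\eta_{\tau_k,p}(\varepsilon)]$. Assume: 1. the predictors are centred, $\frac1T\sum_{t=1}^T\mathbf x_t\to 0$, and $\frac1T\mathbf X'\mathbf X\to\mathbf C$ as $T\to\infty$, where $\mathbf X=(\mathbf x_1,\dots,\mathbf x_T)'$ and $\mathbf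 C$ is positive definite; 2. $E|\varepsilon|^{2(p-1)}<\infty$; 3. there is $\delta>0$ such that $E|\varepsilon-b|^{p-2}<\infty$ whenever $|b-b^*_{\tau_k}|<\delta$ for some $k$ (with $0^{p-2}=\infty$ if $p<2$); and, if $p=2$, $P(\varepsilon=b^*_{\tau_k})=0$ for every $k$ with $\tau_k\ne\frac12$. Let $(\hat b_1,\dots,\hat b_K,\hat{\boldsymbol\beta}^{clp})$ minimise $\sum_{k=1}^K\sum_{t=1}^T\eta_{\tau_k,p}(y_t-b_k-\mathbf x_t'\boldsymbol\beta)$ over $b\in\mathbb R^K$, $\boldsymbol\beta\in\mathbb R^m$, and let $\hat{\boldsymbol\beta}^{Aclp}$ be the $\boldsymbol\beta$-part of a minimiser of $$\sum_{k=1}^K\sum_{t=1}^T\eta_{\tau_k,p}(y_t-b_k-\mathbf x_t'\boldsymbol\beta)+\lambda(T)\sum_{j=1}^m\frac{|\beta_j|}{|\hat\beta^{clp}_j|^2}$$ over $b\in\mathbb R^K$, $\boldsymbol\beta\in\mathbb R^m$ (if $\hat\beta_j^{clp}=0$, the $j$-th penalty term is $0$ for $\beta_j=0$ and $+\infty$ otherwise);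 the estimators are taken measurable. If $\lambda(T)/\sqrt T\to 0$ and $\lambda(T)T^{(p-2)/2}\to\infty$ as $T\to\infty$, then with $\mathcal A=\{j:\beta^*_j\ne0\}$: 1. (Consistency in selection) $P(\{j:\hat\beta^{Aclp}_j\ne0\}=\mathcal A)\to1$. 2. (Asymptotic normality) $\sqrt T(\hat{\boldsymbol\beta}^{Aclp}_{\mathcal A}-\boldsymbol\beta^*_{\mathcal A})$ converges in distribution to $N(0,\boldsymbol\Sigma)$, where $$\boldsymbol\Sigma=\frac{\sum_{k'=1}^K\sum_{k=1}^K E[\varphi_{\tau_{k'},p}(\varepsilon-b^*_{\tau_{k'}})\,\varphi_{\tau_k,p}(\varepsilon-b^*_{\tau_k})]}{\big(\sum_{k=1}^K E\,\psi_{\tau_k,p}(\varepsilon-b^*_{\tau_k})\big)^2}\;\mathbf C_{\mathcal A\mathcal A}^{-1}$$ and $\mathbf C_{\mathcal A\mathcal A}$ is the submatrix of $\mathbf C$ with rows and columns in $\mathcal A$. -/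

import Mathlib

open MeasureTheory ProbabilityTheory Filter Topology Matrix

noncomputable section

namespace CLpQR

/-- The asymmetric weight `|τ - I(s < 0)|`. -/
def weight (τ s : ℝ) : ℝ := |τ - (if s < 0 then 1 else 0)|

/-- The `L^p`-quantile loss `η_{τ,p}(s) = |τ - I(s < 0)| |s|^p`. -/
def eta (p τ s : ℝ) : ℝ := weight τ s * |s| ^ p

/-- `φ_{τ,p}(s) = p |τ - I(s < 0)| |s|^(p-1) sign(s)`. -/
def phi (p τ s : ℝ) : ℝ := p * weight τ s * |s| ^ (p - 1) * Real.sign s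

/-- `ψ_{τ,p}(s) = p (p-1) |τ - I(s < 0)| |s|^(p-2)`. For `p < 2` the value at `s = 0` is
irrelevant wherever `ψ` is used below, because there `s = 0` has probability zero. -/
def psi (p τ s : ℝ) : ℝ := p * (p - 1) * weight τ s * |s| ^ (p - 2)

/-- `b` is a `τ`-th `L^p`-quantile of the law `ν` on the line: a minimiser of the expected
`L^p`-quantile loss `c ↦ E η_{τ,p}(ε - c)`. As usual the loss is recentred by `η_{τ,p}(ε)`, so that
the expectation is finite as soon as `E |ε|^(p-1) < ∞` and `E |ε|^p < ∞` is not needed. -/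
def IsLpQuantile (p τ : ℝ) (ν : Measure ℝ) (b : ℝ) : Prop :=
  ∀ c : ℝ, ∫ s, (eta p τ (s - b) - eta p τ s) ∂ν ≤ ∫ s, (eta p τ (s - c) - eta p τ s) ∂ν

/-- The `T × m` design matrix, whose rows are the first `T` covariate vectors. -/
def designMatrix {m : ℕ} (x : ℕ → Fin m → ℝ) (T : ℕ) : Matrix (Fin T) (Fin m) ℝ :=
  Matrix.of fun t => x t

/-- The composite `L^p`-quantile criterion for the sample of the first `T` observations (which are
numbered `0, …, T - 1`). -/
def objective {m K : ℕ} (p : ℝ) (τ : Fin K → ℝ) (x : ℕ → Fin m → ℝ) (y : ℕ → ℝ) (T : ℕ)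
    (b : Fin K → ℝ) (β : Fin m → ℝ) : ℝ :=
  ∑ k, ∑ t ∈ Finset.range T, eta p (τ k) (y t - b k - x t ⬝ᵥ β)

/-- `(b, β)` is a composite `L^p`-quantile regression estimate. -/
def IsEstimate {m K : ℕ} (p : ℝ) (τ : Fin K → ℝ) (x : ℕ → Fin m → ℝ) (y : ℕ → ℝ) (T : ℕ)
    (b : Fin K → ℝ) (β : Fin m → ℝ) : Prop :=
  ∀ (b' : Fin K → ℝ) (β' : Fin m → ℝ), objective p τ x y T b β ≤ objective p τ x y T b' β'

/-- The adaptive penalty `∑ j, |β j| / |w j| ^ 2`, where `w` is the pilot estimate. -/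
def penalty {m : ℕ} (w β : Fin m → ℝ) : ℝ := ∑ j, |β j| / |w j| ^ 2

/-- `(b, β)` is an adaptively penalised composite `L^p`-quantile regression estimate with penalty
level `lam` and pilot estimate `w`. If `w j = 0`, the penalty `|β j| / |w j| ^ 2` is read as `+∞` for
`β j ≠ 0` and as `0` for `β j = 0`: the minimum is over the `β` that vanish wherever `w` does (and
for these the terms with `w j = 0` are `0 / 0 = 0`). -/
def IsAdaptiveEstimate {m K : ℕ} (p : ℝ) (τ : Fin K → ℝ) (x : ℕ → Fin m → ℝ) (y : ℕ → ℝ) (T : ℕ)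
    (lam : ℝ) (w : Fin m → ℝ) (b : Fin K → ℝ) (β : Fin m → ℝ) : Prop :=
  (∀ j, w j = 0 → β j = 0) ∧
    ∀ (b' : Fin K → ℝ) (β' : Fin m → ℝ), (∀ j, w j = 0 → β' j = 0) →
      objective p τ x y T b β + lam * penalty w β ≤
        objective p τ x y T b' β' + lam * penalty w β'

/-- The scalar factor
`∑ k', ∑ k, E[φ_{k'}(ε - b_{k'}) φ_k(ε - b_k)] / (∑ k, E ψ_k(ε - b_k)) ^ 2`
of the asymptotic covariance matrix, for errors `ε` with law `ν`. -/
def varianceFactor {K : ℕ} (p : ℝ) (τ : Fin K → ℝ) (ν : Measure ℝ) (b : Fin K → ℝ) : ℝ :=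
  (∑ k', ∑ k, ∫ s, phi p (τ k') (s - b k') * phi p (τ k) (s - b k) ∂ν) /
    (∑ k, ∫ s, psi p (τ k) (s - b k) ∂ν) ^ 2

/-- The oracle covariance matrix: the block `C_{AA}` of `C`, with `A` the support of `β`, is inverted
and multiplied by the scalar factor. -/
def oracleCovariance {m K : ℕ} (p : ℝ) (τ : Fin K → ℝ) (ν : Measure ℝ) (b : Fin K → ℝ)
    (C : Matrix (Fin m) (Fin m) ℝ) (β : Fin m → ℝ) :
    Matrix {j : Fin m // β j ≠ 0} {j : Fin m // β j ≠ 0} ℝ :=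
  varianceFactor p τ ν b • (C.submatrix Subtype.val Subtype.val)⁻¹

end CLpQR

end

/-!
Write `θ = (u, v)` for the local parameter with `b = b* + u / √T`, `β = β* + v / √T`. In these
coordinates the criterion, minus its value at the truth, is `Q_T θ - z_T ⬝ᵥ θ` (`objective_sub`): the
score `z_T` is a normalised sum of the derivatives `φ` at the errors, and `Q_T` is a sum of remainders
`η(s - h) - η(s) + h φ(s)`, hence convex and nonnegative.

The remainder `R(s, h)` satisfies both `R ≤ p |h| ^ p` and `R ≤ p |s| ^ (p - 2) h ^ 2`, because `φ` is
Hölder of exponent `p - 1` and, away from the origin, Lipschitz at `s` with constant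
`p |s| ^ (p - 2)`. The negative moment at the quantile therefore suffices, by dominated convergence,
for `E R(ε - b*, h) = (E ψ) h ^ 2 / 2 + o(h ^ 2)` (`integral_rem_isLittleO`), while
`E R ^ 2 = o(h ^ 2)` (`integral_rem_sq_isLittleO`). As `T⁻¹ ∑ (u k + x t ⬝ᵥ v) ^ 2` converges, every
function that is `o(h ^ 2)` sums to zero over the array `(u k + x t ⬝ᵥ v) / √T`
(`tendsto_sum_of_isLittleO`), so Chebyshev's inequality gives `Q_T → q` in probability at each point,
with `q` the quadratic form `limitQuad`; the centred design removes the cross term. Convexity makes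
the convergence uniform on bounded sets (`exists_finset_forall_convexOn`, `tendsto_measure_remSum`).

The score is bounded in probability, so both minimisers stay in a ball of fixed radius with high
probability (`norm_le_of_criterion_le`); for the pilot this is `√T`-consistency. Hence for a zero
coefficient the adaptive penalty has slope at least a multiple of `λ √T → ∞` in local coordinates,
more than the Lipschitz constant of `Q_T - z_T`, and the estimate of that coefficient must vanish; on
the support the penalty is of order `λ / √T → 0`. The estimate is therefore close to the minimiser of
`q - z_T` among parameters with the right support (`adaptive_minimizer`), whose slopes are
`(∑ k, E ψ_k)⁻¹ C_AA⁻¹ z_T`. This is a weighted sum of centred i.i.d. variables, asymptotically normal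
by a direct computation with characteristic functions (`tendsto_prod_charFun`,
`tendstoInDistribution_oracleSlope`).
-/

namespace CLpQR

/-! ### The `L^p`-quantile loss and its derivative -/

lemma weight_nonneg (τ s : ℝ) : 0 ≤ weight τ s := abs_nonneg _

lemma weight_of_nonneg {τ s : ℝ} (hτ : 0 ≤ τ) (hs : 0 ≤ s) : weight τ s = τ := by
  simp [weight, not_lt.2 hs, abs_of_nonneg hτ]

lemma weight_of_neg {τ s : ℝ} (hτ : τ ≤ 1) (hs : s < 0) : weight τ s = 1 - τ := by
  rw [weight, if_pos hs, abs_of_nonpos (by linarith)]; ring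

lemma weight_le_one {τ : ℝ} (hτ0 : 0 ≤ τ) (hτ1 : τ ≤ 1) (s : ℝ) : weight τ s ≤ 1 := by
  rcases lt_or_ge s 0 with hs | hs
  · rw [weight_of_neg hτ1 hs]; linarith
  · rwa [weight_of_nonneg hτ0 hs]

lemma weight_pos {τ : ℝ} (hτ0 : 0 < τ) (hτ1 : τ < 1) (s : ℝ) : 0 < weight τ s := by
  rcases lt_or_ge s 0 with hs | hs
  · rw [weight_of_neg hτ1.le hs]; linarith
  · rwa [weight_of_nonneg hτ0.le hs]

@[fun_prop]
lemma measurable_weight (τ : ℝ) : Measurable (weight τ) := by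
  unfold weight
  have : Measurable fun s : ℝ => if s < 0 then (1 : ℝ) else 0 :=
    Measurable.ite measurableSet_Iio measurable_const measurable_const
  exact continuous_abs.measurable.comp (measurable_const.sub this)

@[fun_prop]
lemma measurable_eta (p τ : ℝ) : Measurable (eta p τ) := by
  unfold eta; fun_prop

@[fun_prop]
lemma measurable_psi (p τ : ℝ) : Measurable (psi p τ) := by
  unfold psi; fun_prop

/-- The weight is locally constant away from the origin. -/
lemma weight_eventuallyEq (τ : ℝ) {s : ℝ} (hs : s ≠ 0) : ∀ᶠ x in 𝓝 s, weight τ x = weight τ s := by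
  rcases lt_or_gt_of_ne hs with h | h
  · filter_upwards [eventually_lt_nhds h] with x hx
    simp [weight, hx, h]
  · filter_upwards [eventually_gt_nhds h] with x hx
    simp [weight, not_lt.2 hx.le, not_lt.2 h.le]

lemma sign_mul_abs_self (s : ℝ) : Real.sign s * |s| = s := by
  rcases lt_trichotomy s 0 with h | rfl | h
  · rw [Real.sign_of_neg h, abs_of_neg h]; ring
  · simp
  · rw [Real.sign_of_pos h, abs_of_pos h]; ring

/-- `φ` in terms of positive and negative parts. -/
lemma phi_eq {p τ : ℝ} (hp : 1 < p) (hτ0 : 0 ≤ τ) (hτ1 : τ ≤ 1) (s : ℝ) :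
    phi p τ s = p * (τ * max s 0 ^ (p - 1) - (1 - τ) * max (-s) 0 ^ (p - 1)) := by
  have h0 : (0 : ℝ) ^ (p - 1) = 0 := Real.zero_rpow (by linarith)
  rcases lt_trichotomy s 0 with hs | rfl | hs
  · rw [phi, weight_of_neg hτ1 hs, abs_of_neg hs, Real.sign_of_neg hs, max_eq_right hs.le,
      max_eq_left (by linarith), h0]
    ring
  · simp [phi, h0]
  · rw [phi, weight_of_nonneg hτ0 hs.le, abs_of_pos hs, Real.sign_of_pos hs, max_eq_left hs.le,
      max_eq_right (by linarith), h0]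
    ring

lemma continuous_phi {p τ : ℝ} (hp : 1 < p) (hτ0 : 0 ≤ τ) (hτ1 : τ ≤ 1) :
    Continuous (phi p τ) := by
  rw [funext (phi_eq hp hτ0 hτ1)]
  have h : Continuous fun x : ℝ => x ^ (p - 1) := Real.continuous_rpow_const (by linarith)
  exact continuous_const.mul ((continuous_const.mul (h.comp (by fun_prop))).sub
    (continuous_const.mul (h.comp (by fun_prop))))

lemma monotone_phi {p τ : ℝ} (hp : 1 < p) (hτ0 : 0 ≤ τ) (hτ1 : τ ≤ 1) : Monotone (phi p τ) := by
  intro a b hab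
  rw [phi_eq hp hτ0 hτ1, phi_eq hp hτ0 hτ1]
  have hr : 0 ≤ p - 1 := by linarith
  have h1 : max a 0 ^ (p - 1) ≤ max b 0 ^ (p - 1) :=
    Real.rpow_le_rpow (le_max_right _ _) (max_le_max_right _ hab) hr
  have h2 : max (-b) 0 ^ (p - 1) ≤ max (-a) 0 ^ (p - 1) :=
    Real.rpow_le_rpow (le_max_right _ _) (max_le_max_right _ (by linarith)) hr
  have h3 : 0 ≤ 1 - τ := by linarith
  gcongr

lemma abs_phi_le {p τ : ℝ} (hp : 1 < p) (hτ0 : 0 ≤ τ) (hτ1 : τ ≤ 1) (s : ℝ) :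
    |phi p τ s| ≤ p * |s| ^ (p - 1) := by
  have hs : |Real.sign s| ≤ 1 := by
    rcases Real.sign_apply_eq s with h | h | h <;> simp [h]
  have hr : 0 ≤ |s| ^ (p - 1) := by positivity
  have hw := weight_le_one hτ0 hτ1 s
  have hw0 := weight_nonneg τ s
  rw [phi, abs_mul, abs_of_nonneg (by positivity : 0 ≤ p * weight τ s * |s| ^ (p - 1))]
  calc p * weight τ s * |s| ^ (p - 1) * |Real.sign s|
      ≤ p * 1 * |s| ^ (p - 1) * 1 := by gcongr
    _ = p * |s| ^ (p - 1) := by ring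

lemma hasDerivAt_eta {p τ : ℝ} (hp : 1 < p) (hτ0 : 0 ≤ τ) (hτ1 : τ ≤ 1) (s : ℝ) :
    HasDerivAt (eta p τ) (phi p τ s) s := by
  have hd := hasDerivAt_abs_rpow s hp
  rcases eq_or_ne s 0 with rfl | hs
  · have h0 : phi p τ 0 = 0 := by simp [phi]
    rw [h0, hasDerivAt_iff_isLittleO]
    rw [mul_zero, hasDerivAt_iff_isLittleO] at hd
    have hz : (0 : ℝ) ^ p = 0 := Real.zero_rpow (by linarith)
    simp only [sub_zero, smul_zero, abs_zero, hz, eta, mul_zero] at hd ⊢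
    refine (Asymptotics.IsBigO.of_bound 1 (Eventually.of_forall fun x => ?_)).trans_isLittleO hd
    rw [norm_mul, Real.norm_eq_abs, abs_of_nonneg (weight_nonneg τ x)]
    gcongr
    exact weight_le_one hτ0 hτ1 x
  · have h1 : eta p τ =ᶠ[𝓝 s] fun x => weight τ s * |x| ^ p := by
      filter_upwards [weight_eventuallyEq τ hs] with x hx
      rw [eta, hx]
    refine (h1.hasDerivAt_iff).2 ?_
    convert! hd.const_mul (weight τ s) using 1
    have h2 : |s| ^ (p - 1) * Real.sign s = |s| ^ (p - 2) * s := by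
      have h3 : |s| ^ (p - 1) = |s| ^ (p - 2) * |s| := by
        rw [← Real.rpow_add_one (abs_ne_zero.2 hs)]; congr 1; ring
      rw [h3, mul_assoc, mul_comm |s|, sign_mul_abs_self]
    rw [phi]
    linear_combination p * weight τ s * h2

lemma convexOn_eta {p τ : ℝ} (hp : 1 < p) (hτ0 : 0 ≤ τ) (hτ1 : τ ≤ 1) :
    ConvexOn ℝ Set.univ (eta p τ) := by
  refine Monotone.convexOn_univ_of_deriv
    (fun s => (hasDerivAt_eta hp hτ0 hτ1 s).differentiableAt) ?_
  rw [funext fun s => (hasDerivAt_eta hp hτ0 hτ1 s).deriv]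
  exact monotone_phi hp hτ0 hτ1

lemma abs_rpow_sub_rpow_le {r a b : ℝ} (hr0 : 0 ≤ r) (hr1 : r ≤ 1) (ha : 0 ≤ a) (hb : 0 ≤ b) :
    |a ^ r - b ^ r| ≤ |a - b| ^ r := by
  wlog hab : b ≤ a generalizing a b
  · rw [abs_sub_comm, abs_sub_comm a]; exact this hb ha (le_of_not_ge hab)
  have h1 : b ^ r ≤ a ^ r := Real.rpow_le_rpow hb hab hr0
  rw [abs_of_nonneg (by linarith), abs_of_nonneg (by linarith : 0 ≤ a - b)]
  have := Real.rpow_add_le_add_rpow hb (by linarith : 0 ≤ a - b) hr0 hr1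
  rw [add_sub_cancel] at this
  linarith

lemma abs_rpow_sub_rpow_le_mul {r a b : ℝ} (hr0 : 0 ≤ r) (hr1 : r ≤ 1) (ha : 0 < a) (hb : 0 ≤ b) :
    |a ^ r - b ^ r| ≤ |a - b| * a ^ (r - 1) := by
  have hd : a ^ (r - 1) = a ^ r / a := Real.rpow_sub_one ha.ne' r
  have har : 0 < a ^ r := Real.rpow_pos_of_pos ha r
  have key : |1 - (b / a) ^ r| ≤ |1 - b / a| := by
    rcases le_total (b / a) 1 with h | h
    · have h1 : b / a ≤ (b / a) ^ r := by
        rcases eq_or_lt_of_le (div_nonneg hb ha.le) with h0 | h0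
        · rw [← h0]; positivity
        · simpa using Real.rpow_le_rpow_of_exponent_ge h0 h hr1
      have h2 : (b / a) ^ r ≤ 1 := Real.rpow_le_one (by positivity) h hr0
      rw [abs_of_nonneg (by linarith), abs_of_nonneg (by linarith)]; linarith
    · have h1 : (b / a) ^ r ≤ b / a := by
        simpa using Real.rpow_le_rpow_of_exponent_le h hr1
      have h2 : 1 ≤ (b / a) ^ r := Real.one_le_rpow h hr0
      rw [abs_of_nonpos (by linarith), abs_of_nonpos (by linarith)]; linarith
  have e1 : a ^ r - b ^ r = a ^ r * (1 - (b / a) ^ r) := by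
    rw [Real.div_rpow hb ha.le]; field_simp
  have e2 : |a - b| * a ^ (r - 1) = a ^ r * |1 - b / a| := by
    have : a - b = a * (1 - b / a) := by field_simp
    rw [this, abs_mul, abs_of_pos ha, hd]; field_simp
  rw [e1, e2, abs_mul, abs_of_pos har]
  gcongr

/-- `φ` is Hölder continuous of exponent `p - 1`. -/
lemma abs_phi_sub_le {p τ : ℝ} (hp : 1 < p) (hp2 : p ≤ 2) (hτ0 : 0 ≤ τ) (hτ1 : τ ≤ 1) (s t : ℝ) :
    |phi p τ s - phi p τ t| ≤ p * |s - t| ^ (p - 1) := by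
  have hr : 0 ≤ p - 1 := by linarith
  rw [phi_eq hp hτ0 hτ1, phi_eq hp hτ0 hτ1]
  have h1 : |max s 0 ^ (p - 1) - max t 0 ^ (p - 1)| ≤ |s - t| ^ (p - 1) :=
    (abs_rpow_sub_rpow_le hr (by linarith) (le_max_right _ _) (le_max_right _ _)).trans
      (Real.rpow_le_rpow (abs_nonneg _) (abs_max_sub_max_le_abs _ _ _) hr)
  have h2 : |max (-s) 0 ^ (p - 1) - max (-t) 0 ^ (p - 1)| ≤ |s - t| ^ (p - 1) := by
    refine (abs_rpow_sub_rpow_le hr (by linarith) (le_max_right _ _) (le_max_right _ _)).trans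
      (Real.rpow_le_rpow (abs_nonneg _) ((abs_max_sub_max_le_abs _ _ _).trans ?_) hr)
    rw [← neg_sub', abs_neg]
  rw [abs_le] at h1 h2
  rw [← mul_sub, abs_mul, abs_of_pos (by linarith : 0 < p)]
  gcongr
  rw [abs_le]
  have : 0 ≤ 1 - τ := by linarith
  constructor <;> nlinarith

/-- Away from the origin `φ` is Lipschitz at `s`, with constant `p |s| ^ (p - 2)`. -/
lemma abs_phi_sub_le_mul {p τ : ℝ} (hp : 1 < p) (hp2 : p ≤ 2) (hτ0 : 0 ≤ τ) (hτ1 : τ ≤ 1)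
    {s : ℝ} (hs : s ≠ 0) (t : ℝ) :
    |phi p τ s - phi p τ t| ≤ p * (|s - t| * |s| ^ (p - 2)) := by
  have hr : 0 ≤ p - 1 := by linarith
  have hs' : 0 < |s| := abs_pos.2 hs
  rcases le_or_gt |s| |s - t| with h | h
  · refine (abs_phi_sub_le hp hp2 hτ0 hτ1 s t).trans ?_
    have h0 : 0 < |s - t| := hs'.trans_le h
    have h1 : |s - t| ^ (p - 1) = |s - t| * |s - t| ^ (p - 2) := by
      rw [mul_comm, ← Real.rpow_add_one h0.ne']; congr 1; ring
    rw [h1]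
    gcongr ?_ * (_ * ?_)
    exact Real.rpow_le_rpow_of_nonpos hs' h (by linarith)
  · rw [show p - 2 = p - 1 - 1 by ring]
    have h0 : (0 : ℝ) ^ (p - 1) = 0 := Real.zero_rpow (by linarith)
    rw [phi_eq hp hτ0 hτ1, phi_eq hp hτ0 hτ1, ← mul_sub, abs_mul, abs_of_pos (by linarith : 0 < p)]
    gcongr
    rcases lt_or_gt_of_ne hs with hn | hn
    · rw [abs_of_neg hn] at h ⊢
      have ht : t < 0 := by have := neg_abs_le (s - t); linarith
      rw [max_eq_right hn.le, max_eq_right ht.le, max_eq_left (by linarith : 0 ≤ -s),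
        max_eq_left (by linarith : 0 ≤ -t), h0]
      have := abs_rpow_sub_rpow_le_mul hr (by linarith) (by linarith : 0 < -s)
        (by linarith : 0 ≤ -t)
      rw [← neg_sub', abs_neg] at this
      have h3 : τ * 0 - (1 - τ) * (-s) ^ (p - 1) - (τ * 0 - (1 - τ) * (-t) ^ (p - 1)) =
        -((1 - τ) * ((-s) ^ (p - 1) - (-t) ^ (p - 1))) := by ring
      rw [h3, abs_neg, abs_mul, abs_of_nonneg (by linarith : 0 ≤ 1 - τ)]
      exact (mul_le_of_le_one_left (abs_nonneg _) (by linarith)).trans this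
    · rw [abs_of_pos hn] at h ⊢
      have ht : 0 < t := by have := le_abs_self (s - t); linarith
      rw [max_eq_left hn.le, max_eq_left ht.le, max_eq_right (by linarith : -s ≤ 0),
        max_eq_right (by linarith : -t ≤ 0), h0]
      have := abs_rpow_sub_rpow_le_mul hr (by linarith) hn ht.le
      have h3 : τ * s ^ (p - 1) - (1 - τ) * 0 - (τ * t ^ (p - 1) - (1 - τ) * 0) =
        τ * (s ^ (p - 1) - t ^ (p - 1)) := by ring
      rw [h3, abs_mul, abs_of_nonneg hτ0]
      exact (mul_le_of_le_one_left (abs_nonneg _) (by linarith)).trans this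

lemma hasDerivAt_phi {p τ : ℝ} {s : ℝ} (hs : s ≠ 0) :
    HasDerivAt (phi p τ) (psi p τ s) s := by
  have hsg : ∀ᶠ x in 𝓝 s, Real.sign x = Real.sign s := by
    rcases lt_or_gt_of_ne hs with h | h
    · filter_upwards [eventually_lt_nhds h] with x hx
      rw [Real.sign_of_neg hx, Real.sign_of_neg h]
    · filter_upwards [eventually_gt_nhds h] with x hx
      rw [Real.sign_of_pos hx, Real.sign_of_pos h]
  have h1 : phi p τ =ᶠ[𝓝 s] fun x => p * weight τ s * |x| ^ (p - 1) * Real.sign s := by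
    filter_upwards [weight_eventuallyEq τ hs, hsg] with x hx hx'
    rw [phi, hx, hx']
  refine h1.hasDerivAt_iff.2 ?_
  have h2 : HasDerivAt (fun x : ℝ => |x|) (SignType.sign s : ℝ) s := hasDerivAt_abs hs
  have h3 := ((h2.rpow_const (p := p - 1) (Or.inl (abs_ne_zero.2 hs))).const_mul
    (p * weight τ s)).mul_const (Real.sign s)
  convert! h3 using 1
  have h4 : (SignType.sign s : ℝ) * Real.sign s = 1 := by
    rcases lt_or_gt_of_ne hs with h | h
    · rw [Real.sign_of_neg h, sign_neg h]; simp
    · rw [Real.sign_of_pos h, sign_pos h]; simp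
  rw [psi, show p - 1 - 1 = p - 2 by ring]
  linear_combination (- (p * (p - 1) * weight τ s * |s| ^ (p - 2))) * h4

/-! ### The second-order remainder of the loss -/

/-- The remainder of the first-order expansion of `h ↦ η(s - h)` at `h = 0`. -/
noncomputable def rem (p τ s h : ℝ) : ℝ := eta p τ (s - h) - eta p τ s + h * phi p τ s

@[simp] lemma rem_zero (p τ s : ℝ) : rem p τ s 0 = 0 := by simp [rem]

lemma measurable_phi {p τ : ℝ} (hp : 1 < p) (hτ0 : 0 ≤ τ) (hτ1 : τ ≤ 1) : Measurable (phi p τ) :=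
  (continuous_phi hp hτ0 hτ1).measurable

lemma measurable_rem {p τ : ℝ} (hp : 1 < p) (hτ0 : 0 ≤ τ) (hτ1 : τ ≤ 1) (h : ℝ) :
    Measurable fun s => rem p τ s h := by
  have := measurable_phi hp hτ0 hτ1
  unfold rem
  fun_prop

lemma convexOn_rem {p τ : ℝ} (hp : 1 < p) (hτ0 : 0 ≤ τ) (hτ1 : τ ≤ 1) (s : ℝ) :
    ConvexOn ℝ Set.univ (rem p τ s) := by
  refine ⟨convex_univ, fun x _ y _ a b ha hb hab => ?_⟩
  have := (convexOn_eta hp hτ0 hτ1).2 (Set.mem_univ (s - x)) (Set.mem_univ (s - y)) ha hb hab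
  simp only [smul_eq_mul, rem] at this ⊢
  have e : a * (s - x) + b * (s - y) = s - (a * x + b * y) := by
    linear_combination s * hab
  rw [e] at this
  linear_combination this + eta p τ s * hab

/-- Mean value form of the remainder. -/
lemma exists_rem_eq {p τ : ℝ} (hp : 1 < p) (hτ0 : 0 ≤ τ) (hτ1 : τ ≤ 1) (s h : ℝ) :
    ∃ t ∈ Set.uIcc (s - h) s, rem p τ s h = h * (phi p τ s - phi p τ t) := by
  have hd := hasDerivAt_eta hp hτ0 hτ1
  have hc : Continuous (eta p τ) := continuous_iff_continuousAt.2 fun x => (hd x).continuousAt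
  rcases lt_trichotomy h 0 with hh | rfl | hh
  · obtain ⟨t, ht, e⟩ := exists_hasDerivAt_eq_slope (eta p τ) (phi p τ) (by linarith : s < s - h)
      hc.continuousOn fun x _ => hd x
    refine ⟨t, ?_, ?_⟩
    · rw [Set.uIcc_of_ge (by linarith)]; exact Set.Ioo_subset_Icc_self ht
    · have : s - h - s ≠ 0 := by linarith
      rw [eq_div_iff this] at e
      rw [rem]; linear_combination -e
  · exact ⟨s, by simp, by simp⟩
  · obtain ⟨t, ht, e⟩ := exists_hasDerivAt_eq_slope (eta p τ) (phi p τ) (by linarith : s - h < s)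
      hc.continuousOn fun x _ => hd x
    refine ⟨t, ?_, ?_⟩
    · rw [Set.uIcc_of_le (by linarith)]; exact Set.Ioo_subset_Icc_self ht
    · have : s - (s - h) ≠ 0 := by linarith
      rw [eq_div_iff this] at e
      rw [rem]; linear_combination e

lemma rem_nonneg {p τ : ℝ} (hp : 1 < p) (hτ0 : 0 ≤ τ) (hτ1 : τ ≤ 1) (s h : ℝ) :
    0 ≤ rem p τ s h := by
  obtain ⟨t, ht, e⟩ := exists_rem_eq hp hτ0 hτ1 s h
  rw [e]
  rcases le_total h 0 with hh | hh
  · rw [Set.uIcc_of_ge (by linarith)] at ht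
    have := monotone_phi hp hτ0 hτ1 ht.1
    nlinarith
  · rw [Set.uIcc_of_le (by linarith)] at ht
    have := monotone_phi hp hτ0 hτ1 ht.2
    exact mul_nonneg hh (by linarith)

lemma abs_sub_le_of_mem_uIcc {s h t : ℝ} (ht : t ∈ Set.uIcc (s - h) s) : |s - t| ≤ |h| := by
  simpa using Set.abs_sub_right_of_mem_uIcc ht

lemma rem_le_rpow {p τ : ℝ} (hp : 1 < p) (hp2 : p ≤ 2) (hτ0 : 0 ≤ τ) (hτ1 : τ ≤ 1) (s h : ℝ) :
    rem p τ s h ≤ p * |h| ^ p := by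
  rcases eq_or_ne h 0 with rfl | hh
  · simp only [rem_zero]; positivity
  obtain ⟨t, ht, e⟩ := exists_rem_eq hp hτ0 hτ1 s h
  have h1 := abs_phi_sub_le hp hp2 hτ0 hτ1 s t
  have h2 : |s - t| ^ (p - 1) ≤ |h| ^ (p - 1) :=
    Real.rpow_le_rpow (abs_nonneg _) (abs_sub_le_of_mem_uIcc ht) (by linarith)
  have h3 : |h| ^ p = |h| * |h| ^ (p - 1) := by
    rw [mul_comm, ← Real.rpow_add_one (abs_ne_zero.2 hh)]; congr 1; ring
  calc rem p τ s h ≤ |h| * |phi p τ s - phi p τ t| := by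
        rw [e, ← abs_mul]; exact le_abs_self _
    _ ≤ |h| * (p * |h| ^ (p - 1)) := by gcongr; exact h1.trans (by gcongr)
    _ = p * |h| ^ p := by rw [h3]; ring

lemma rem_le_sq {p τ : ℝ} (hp : 1 < p) (hp2 : p ≤ 2) (hτ0 : 0 ≤ τ) (hτ1 : τ ≤ 1) {s : ℝ}
    (hs : s ≠ 0) (h : ℝ) : rem p τ s h ≤ p * |s| ^ (p - 2) * h ^ 2 := by
  obtain ⟨t, ht, e⟩ := exists_rem_eq hp hτ0 hτ1 s h
  have h1 := abs_phi_sub_le_mul hp hp2 hτ0 hτ1 hs t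
  have h2 := abs_sub_le_of_mem_uIcc ht
  calc rem p τ s h ≤ |h| * |phi p τ s - phi p τ t| := by
        rw [e, ← abs_mul]; exact le_abs_self _
    _ ≤ |h| * (p * (|h| * |s| ^ (p - 2))) := by gcongr; exact h1.trans (by gcongr)
    _ = p * |s| ^ (p - 2) * h ^ 2 := by rw [← sq_abs h]; ring

lemma tendsto_rem_div_sq {p τ : ℝ} (hp : 1 < p) (hτ0 : 0 ≤ τ) (hτ1 : τ ≤ 1) {s : ℝ}
    (hs : s ≠ 0) :
    Tendsto (fun h => rem p τ s h / h ^ 2) (𝓝[≠] 0) (𝓝 (psi p τ s / 2)) := by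
  have hrd : ∀ h, HasDerivAt (rem p τ s) (phi p τ s - phi p τ (s - h)) h := fun h => by
    have h1 : HasDerivAt (fun h : ℝ => s - h) (-1) h := by
      simpa using (hasDerivAt_id h).const_sub s
    have h2 := (((hasDerivAt_eta hp hτ0 hτ1 (s - h)).comp h h1).sub_const (eta p τ s)).add
      ((hasDerivAt_id h).mul_const (phi p τ s))
    convert! h2 using 1
    ring
  refine HasDerivAt.lhopital_zero_nhdsNE (f' := fun h => phi p τ s - phi p τ (s - h))
    (g' := fun h => 2 * h) (Eventually.of_forall hrd)
    (Eventually.of_forall fun h => by simpa using hasDerivAt_pow 2 h)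
    (by filter_upwards [self_mem_nhdsWithin] with h hh; simpa using hh) ?_ ?_ ?_
  · have := (hrd 0).continuousAt.tendsto
    rw [rem_zero] at this
    exact this.mono_left nhdsWithin_le_nhds
  · have : Tendsto (fun h : ℝ => h ^ 2) (𝓝 0) (𝓝 (0 ^ 2)) := (continuous_pow 2).tendsto 0
    rw [zero_pow two_ne_zero] at this
    exact this.mono_left nhdsWithin_le_nhds
  · have h1 : HasDerivAt (fun h : ℝ => s - h) (-1) 0 := by
      simpa using (hasDerivAt_id (0 : ℝ)).const_sub s
    have h2 : HasDerivAt (phi p τ) (psi p τ s) (s - 0) := by rw [sub_zero]; exact hasDerivAt_phi hs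
    have h3 := (h2.comp 0 h1).tendsto_slope
    have h4 := (h3.const_mul (-1)).div_const 2
    rw [show -1 * (psi p τ s * -1) / 2 = psi p τ s / 2 by ring] at h4
    refine h4.congr' ?_
    filter_upwards [self_mem_nhdsWithin] with h hh
    have hh' : h ≠ 0 := hh
    simp only [slope_def_field, Function.comp, sub_zero]
    field_simp
    ring

/-- For the squared-error loss the remainder is exactly quadratic. -/
lemma rem_two_half (s h : ℝ) : rem 2 (1 / 2) s h = psi 2 (1 / 2) s / 2 * h ^ 2 := by
  have hw : ∀ s, weight (1 / 2) s = 1 / 2 := fun s => by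
    rcases lt_or_ge s 0 with hs | hs
    · rw [weight_of_neg (by norm_num) hs]; norm_num
    · rw [weight_of_nonneg (by norm_num) hs]
  have h1 : phi 2 (1 / 2) s = s := by
    rw [phi, hw, show (2 : ℝ) - 1 = 1 by norm_num, Real.rpow_one]
    rw [mul_assoc, mul_comm |s|, sign_mul_abs_self]; ring
  rw [rem, h1, eta, eta, psi, hw, hw]
  simp only [Real.rpow_two, sq_abs, sub_self, Real.rpow_zero]
  ring

/-! ### The remainder and the score under the error law -/

section Law

variable {p τ b : ℝ} {ν : Measure ℝ}

/-- The negative moment in extended nonnegative numbers controls the real power, which has the junk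
value `0` at `s = b` when `p < 2`. -/
lemma integrable_abs_sub_rpow [IsFiniteMeasure ν] (hp2 : p ≤ 2)
    (h : ∫⁻ s, ENNReal.ofReal |s - b| ^ (p - 2) ∂ν < ⊤) :
    Integrable (fun s => |s - b| ^ (p - 2)) ν := by
  have hm : Measurable fun s : ℝ => |s - b| ^ (p - 2) := by fun_prop
  refine ⟨hm.aestronglyMeasurable, ?_⟩
  rw [hasFiniteIntegral_iff_ofReal (Eventually.of_forall fun s => by positivity)]
  refine lt_of_le_of_lt (lintegral_mono fun s => ?_) h
  rcases eq_or_lt_of_le (abs_nonneg (s - b)) with h0 | h0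
  · rcases eq_or_lt_of_le hp2 with h2 | h2
    · simp [h2]
    · rw [← h0, ENNReal.ofReal_zero, ENNReal.zero_rpow_of_neg (by linarith)]; exact le_top
  · rw [ENNReal.ofReal_rpow_of_pos h0]

/-- No mass sits at a point where the second derivative of the loss does not exist. -/
lemma ae_ne_or (hp2 : p ≤ 2) (h : ∫⁻ s, ENNReal.ofReal |s - b| ^ (p - 2) ∂ν < ⊤)
    (hatom : p = 2 → τ ≠ 1 / 2 → ν {b} = 0) : ∀ᵐ s ∂ν, s ≠ b ∨ (p = 2 ∧ τ = 1 / 2) := by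
  rcases eq_or_lt_of_le hp2 with h2 | h2
  · by_cases hτ : τ = 1 / 2
    · exact Eventually.of_forall fun s => Or.inr ⟨h2, hτ⟩
    · have := hatom h2 hτ
      filter_upwards [compl_mem_ae_iff.2 this] with s hs
      exact Or.inl hs
  · filter_upwards [ae_lt_top (by fun_prop) h.ne] with s hs
    refine Or.inl fun e => ?_
    rw [e, sub_self, abs_zero, ENNReal.ofReal_zero, ENNReal.zero_rpow_of_neg (by linarith)] at hs
    exact lt_irrefl _ hs

lemma memLp_phi [IsFiniteMeasure ν] (hp : 1 < p) (hp2 : p ≤ 2) (hτ0 : 0 ≤ τ) (hτ1 : τ ≤ 1)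
    (hmoment : Integrable (fun s : ℝ => |s| ^ (2 * (p - 1))) ν) (b : ℝ) :
    MemLp (fun s => phi p τ (s - b)) 2 ν := by
  have hm := measurable_phi hp hτ0 hτ1
  have h1 : MemLp (fun s : ℝ => |s| ^ (p - 1)) 2 ν := by
    have hmeas : Measurable fun s : ℝ => |s| ^ (p - 1) := by fun_prop
    rw [memLp_two_iff_integrable_sq hmeas.aestronglyMeasurable]
    refine hmoment.congr (Eventually.of_forall fun s => ?_)
    simp only
    rw [← Real.rpow_mul_natCast (abs_nonneg s)]
    congr 1; push_cast; ring
  have h2 : MemLp (fun s : ℝ => p * (|s| ^ (p - 1) + |b| ^ (p - 1))) 2 ν :=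
    (h1.add (memLp_const _)).const_mul p
  refine h2.of_le (hm.comp (measurable_id.sub_const b)).aestronglyMeasurable
    (Eventually.of_forall fun s => ?_)
  have h0 : 0 ≤ p * (|s| ^ (p - 1) + |b| ^ (p - 1)) := by positivity
  rw [Real.norm_eq_abs, Real.norm_eq_abs, abs_of_nonneg h0]
  refine (abs_phi_le hp hτ0 hτ1 _).trans ?_
  gcongr
  exact (Real.rpow_le_rpow (abs_nonneg _) (abs_sub s b) (by linarith)).trans
    (Real.rpow_add_le_add_rpow (abs_nonneg _) (abs_nonneg _) (by linarith) (by linarith))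

lemma memLp_rem [IsFiniteMeasure ν] (hp : 1 < p) (hp2 : p ≤ 2) (hτ0 : 0 ≤ τ) (hτ1 : τ ≤ 1)
    (b h : ℝ) (r : ENNReal) : MemLp (fun s => rem p τ (s - b) h) r ν := by
  have hm := measurable_rem hp hτ0 hτ1 h
  refine MemLp.of_bound (C := p * |h| ^ p)
    (hm.comp (measurable_id.sub_const b)).aestronglyMeasurable (Eventually.of_forall fun s => ?_)
  rw [Real.norm_eq_abs, abs_of_nonneg (rem_nonneg hp hτ0 hτ1 _ _)]
  exact rem_le_rpow hp hp2 hτ0 hτ1 _ _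

lemma integrable_rem [IsFiniteMeasure ν] (hp : 1 < p) (hp2 : p ≤ 2) (hτ0 : 0 ≤ τ) (hτ1 : τ ≤ 1)
    (b h : ℝ) : Integrable (fun s => rem p τ (s - b) h) ν :=
  (memLp_rem hp hp2 hτ0 hτ1 b h 1).integrable le_rfl

lemma rem_sub_le_sq (hp : 1 < p) (hp2 : p ≤ 2) (hτ0 : 0 ≤ τ) (hτ1 : τ ≤ 1) {s : ℝ}
    (hs : s ≠ b ∨ (p = 2 ∧ τ = 1 / 2)) (h : ℝ) :
    rem p τ (s - b) h ≤ p * |s - b| ^ (p - 2) * h ^ 2 := by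
  rcases hs with hs | ⟨rfl, rfl⟩
  · exact rem_le_sq hp hp2 hτ0 hτ1 (sub_ne_zero.2 hs) h
  · rw [rem_two_half, psi]
    have := weight_le_one hτ0 hτ1 (s - b)
    simp only [sub_self, Real.rpow_zero]
    nlinarith [sq_nonneg h]

lemma tendsto_rem_sub_div_sq (hp : 1 < p) (hτ0 : 0 ≤ τ) (hτ1 : τ ≤ 1) {s : ℝ}
    (hs : s ≠ b ∨ (p = 2 ∧ τ = 1 / 2)) :
    Tendsto (fun h => rem p τ (s - b) h / h ^ 2) (𝓝[≠] 0) (𝓝 (psi p τ (s - b) / 2)) := by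
  rcases hs with hs | ⟨rfl, rfl⟩
  · exact tendsto_rem_div_sq hp hτ0 hτ1 (sub_ne_zero.2 hs)
  · refine tendsto_const_nhds.congr' ?_
    filter_upwards [self_mem_nhdsWithin] with h hh
    have hh' : h ≠ 0 := hh
    rw [rem_two_half]
    field_simp

lemma integrable_psi (hp : 1 < p) (hτ0 : 0 ≤ τ) (hτ1 : τ ≤ 1)
    (hint : Integrable (fun s => |s - b| ^ (p - 2)) ν) :
    Integrable (fun s => psi p τ (s - b)) ν := by
  refine (hint.const_mul (p * (p - 1))).mono'
    ((measurable_psi p τ).comp (measurable_id.sub_const b)).aestronglyMeasurable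
    (Eventually.of_forall fun s => ?_)
  have h1 := weight_le_one hτ0 hτ1 (s - b)
  have h0 := weight_nonneg τ (s - b)
  have h2 : 0 ≤ p * (p - 1) := mul_nonneg (by linarith) (by linarith)
  rw [psi, Real.norm_eq_abs, abs_of_nonneg (by positivity)]
  exact mul_le_mul_of_nonneg_right (mul_le_of_le_one_right h2 h1) (by positivity)

lemma integral_psi_pos [IsProbabilityMeasure ν] (hp : 1 < p) (hτ0 : 0 < τ) (hτ1 : τ < 1)
    (hint : Integrable (fun s => |s - b| ^ (p - 2)) ν)
    (hne : ∀ᵐ s ∂ν, s ≠ b ∨ (p = 2 ∧ τ = 1 / 2)) : 0 < ∫ s, psi p τ (s - b) ∂ν := by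
  have hpos : ∀ᵐ s ∂ν, 0 < psi p τ (s - b) := by
    filter_upwards [hne] with s hs
    have h0 := weight_pos hτ0 hτ1 (s - b)
    have h2 : 0 < p * (p - 1) := mul_pos (by linarith) (by linarith)
    have h3 : 0 < |s - b| ^ (p - 2) := by
      rcases hs with hs | ⟨rfl, rfl⟩
      · exact Real.rpow_pos_of_pos (abs_pos.2 (sub_ne_zero.2 hs)) _
      · simp
    rw [psi]; positivity
  have hnn : 0 ≤ᵐ[ν] fun s => psi p τ (s - b) := hpos.mono fun s hs => hs.le
  refine lt_of_le_of_ne (integral_nonneg_of_ae hnn) fun h => ?_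
  have h0 := (integral_eq_zero_iff_of_nonneg_ae hnn (integrable_psi hp hτ0.le hτ1.le hint)).1 h.symm
  have : ∀ᵐ s ∂ν, False := by
    filter_upwards [h0, hpos] with s hs hs'
    exact hs'.ne' hs
  exact this.exists.elim fun _ h => h

/-- Second-order expansion of the expected loss. The negative moment dominates the difference
quotients of `φ`, so no bound on that moment that is uniform in `b` is needed. -/
lemma integral_rem_isLittleO [IsProbabilityMeasure ν] (hp : 1 < p) (hp2 : p ≤ 2) (hτ0 : 0 ≤ τ)
    (hτ1 : τ ≤ 1) (hint : Integrable (fun s => |s - b| ^ (p - 2)) ν)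
    (hne : ∀ᵐ s ∂ν, s ≠ b ∨ (p = 2 ∧ τ = 1 / 2)) :
    (fun h => ∫ s, rem p τ (s - b) h ∂ν - (∫ s, psi p τ (s - b) ∂ν) / 2 * h ^ 2) =o[𝓝 0]
      fun h : ℝ => h ^ 2 := by
  have key : Tendsto (fun h : ℝ => ∫ s, rem p τ (s - b) h / h ^ 2 ∂ν) (𝓝[≠] 0)
      (𝓝 (∫ s, psi p τ (s - b) / 2 ∂ν)) := by
    refine tendsto_integral_filter_of_dominated_convergence (fun s => p * |s - b| ^ (p - 2))
      (Eventually.of_forall fun h => ?_) ?_ (hint.const_mul p) ?_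
    · exact (((measurable_rem hp hτ0 hτ1 h).comp (measurable_id.sub_const b)).div_const
        _).aestronglyMeasurable
    · filter_upwards [self_mem_nhdsWithin] with h hh
      have hh' : 0 < h ^ 2 := (sq_pos_of_ne_zero hh)
      filter_upwards [hne] with s hs
      rw [Real.norm_eq_abs, abs_of_nonneg (div_nonneg (rem_nonneg hp hτ0 hτ1 _ _) hh'.le),
        div_le_iff₀ hh']
      exact rem_sub_le_sq hp hp2 hτ0 hτ1 hs h
    · filter_upwards [hne] with s hs
      exact tendsto_rem_sub_div_sq hp hτ0 hτ1 hs
  simp_rw [integral_div] at key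
  rw [Asymptotics.isLittleO_iff_tendsto (fun h hh => by
    have : h = 0 := by simpa using hh
    simp [this])]
  have hc : ContinuousAt (fun h : ℝ => (∫ s, rem p τ (s - b) h ∂ν -
      (∫ s, psi p τ (s - b) ∂ν) / 2 * h ^ 2) / h ^ 2) 0 := by
    rw [continuousAt_iff_punctured_nhds]
    have h1 := key.sub_const ((∫ s, psi p τ (s - b) ∂ν) / 2)
    rw [sub_self] at h1
    simp only [zero_pow two_ne_zero, div_zero]
    refine h1.congr' ?_
    filter_upwards [self_mem_nhdsWithin] with h hh
    have hh' : h ≠ 0 := hh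
    field_simp
  simpa [ContinuousAt] using hc

lemma integral_rem_isBigO [IsProbabilityMeasure ν] (hp : 1 < p) (hp2 : p ≤ 2) (hτ0 : 0 ≤ τ)
    (hτ1 : τ ≤ 1) (hint : Integrable (fun s => |s - b| ^ (p - 2)) ν)
    (hne : ∀ᵐ s ∂ν, s ≠ b ∨ (p = 2 ∧ τ = 1 / 2)) :
    (fun h => ∫ s, rem p τ (s - b) h ∂ν) =O[𝓝 0] fun h : ℝ => h ^ 2 := by
  have h1 := (integral_rem_isLittleO hp hp2 hτ0 hτ1 hint hne).isBigO
  have h2 : (fun h : ℝ => (∫ s, psi p τ (s - b) ∂ν) / 2 * h ^ 2) =O[𝓝 0] fun h : ℝ => h ^ 2 :=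
    Asymptotics.isBigO_const_mul_self _ _ _
  simpa using h1.add h2

/-- The second moment of the remainder is negligible: one factor is bounded by `p |h| ^ p`, and the
mean of the other is `O(h ^ 2)`. -/
lemma integral_rem_sq_isLittleO [IsProbabilityMeasure ν] (hp : 1 < p) (hp2 : p ≤ 2) (hτ0 : 0 ≤ τ)
    (hτ1 : τ ≤ 1) (hint : Integrable (fun s => |s - b| ^ (p - 2)) ν)
    (hne : ∀ᵐ s ∂ν, s ≠ b ∨ (p = 2 ∧ τ = 1 / 2)) :
    (fun h => ∫ s, rem p τ (s - b) h ^ 2 ∂ν) =o[𝓝 0] fun h : ℝ => h ^ 2 := by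
  have h1 : (fun h : ℝ => p * |h| ^ p) =o[𝓝 0] fun _ : ℝ => (1 : ℝ) := by
    rw [Asymptotics.isLittleO_one_iff]
    have hc : Continuous fun h : ℝ => p * |h| ^ p :=
      continuous_const.mul (continuous_abs.rpow_const fun _ => Or.inr (by linarith))
    simpa [Real.zero_rpow (by linarith : p ≠ 0)] using hc.tendsto 0
  have h2 := h1.mul_isBigO (integral_rem_isBigO hp hp2 hτ0 hτ1 hint hne)
  simp only [one_mul] at h2
  refine Asymptotics.IsBigO.trans_isLittleO
    (Asymptotics.IsBigO.of_bound 1 (Eventually.of_forall fun h => ?_)) h2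
  rw [one_mul, Real.norm_eq_abs, Real.norm_eq_abs, abs_of_nonneg (integral_nonneg fun s =>
    sq_nonneg _)]
  refine le_trans ?_ (le_abs_self _)
  rw [← integral_const_mul]
  refine integral_mono_of_nonneg (Eventually.of_forall fun s => sq_nonneg _)
    ((integrable_rem hp hp2 hτ0 hτ1 b h).const_mul _) (Eventually.of_forall fun s => ?_)
  simp only [sq]
  exact mul_le_mul_of_nonneg_right (rem_le_rpow hp hp2 hτ0 hτ1 _ _) (rem_nonneg hp hτ0 hτ1 _ _)

/-- First-order condition: the score has mean zero at the quantile. -/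
lemma integral_phi_eq_zero [IsProbabilityMeasure ν] (hp : 1 < p) (hp2 : p ≤ 2) (hτ0 : 0 ≤ τ)
    (hτ1 : τ ≤ 1) (hmoment : Integrable (fun s : ℝ => |s| ^ (2 * (p - 1))) ν)
    (hint : Integrable (fun s => |s - b| ^ (p - 2)) ν)
    (hne : ∀ᵐ s ∂ν, s ≠ b ∨ (p = 2 ∧ τ = 1 / 2)) (hb : IsLpQuantile p τ ν b) :
    ∫ s, phi p τ (s - b) ∂ν = 0 := by
  have hphi : ∀ c, Integrable (fun s => phi p τ (s - c)) ν := fun c =>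
    (memLp_phi hp hp2 hτ0 hτ1 hmoment c).integrable one_le_two
  have hrem : ∀ c h, Integrable (fun s => rem p τ (s - c) h) ν := fun c h =>
    integrable_rem hp hp2 hτ0 hτ1 c h
  have heta : ∀ c, Integrable (fun s => eta p τ (s - c) - eta p τ s) ν := fun c => by
    have := (hrem 0 c).sub ((hphi 0).const_mul c)
    refine this.congr (Eventually.of_forall fun s => ?_)
    simp [rem]
  set f : ℝ → ℝ := fun h => ∫ s, rem p τ (s - b) h ∂ν - h * ∫ s, phi p τ (s - b) ∂ν with hf
  have hf0 : f 0 = 0 := by simp [hf]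
  have hmin : IsLocalMin f 0 := Eventually.of_forall fun h => by
    rw [hf0]
    have h1 := hb (b + h)
    rw [← sub_nonneg, ← integral_sub (heta _) (heta _)] at h1
    refine h1.trans_eq ?_
    rw [hf]
    simp only
    rw [← integral_const_mul, ← integral_sub (hrem _ _) ((hphi _).const_mul _)]
    refine integral_congr_ae (Eventually.of_forall fun s => ?_)
    simp only [rem]
    rw [show s - (b + h) = s - b - h by ring]
    ring
  have hr : HasDerivAt (fun h => ∫ s, rem p τ (s - b) h ∂ν) 0 0 := by
    rw [hasDerivAt_iff_isLittleO]
    simp only [sub_zero, smul_zero, rem_zero, integral_zero]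
    refine (integral_rem_isBigO hp hp2 hτ0 hτ1 hint hne).trans_isLittleO ?_
    simpa using Asymptotics.isLittleO_pow_pow (𝕜 := ℝ) (one_lt_two)
  have hd : HasDerivAt f (0 - 1 * ∫ s, phi p τ (s - b) ∂ν) 0 :=
    hr.sub ((hasDerivAt_id (0 : ℝ)).mul_const _)
  have := hmin.hasDerivAt_eq_zero hd
  linarith

end Law

/-! ### Sums over a negligible array -/

section Array

variable {z : ℕ → ℝ} {S : ℝ}

lemma sum_div_sqrt_sq (z : ℕ → ℝ) (T : ℕ) :
    ∑ t ∈ Finset.range T, (z t / √(T : ℝ)) ^ 2 = (T : ℝ)⁻¹ * ∑ t ∈ Finset.range T, z t ^ 2 := by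
  rw [Finset.mul_sum]
  refine Finset.sum_congr rfl fun t _ => ?_
  rw [div_pow, Real.sq_sqrt (Nat.cast_nonneg T)]; ring

lemma tendsto_sq_div_nat (hz : Tendsto (fun T : ℕ => (T : ℝ)⁻¹ * ∑ t ∈ Finset.range T, z t ^ 2)
    atTop (𝓝 S)) : Tendsto (fun T : ℕ => z T ^ 2 / (T : ℝ)) atTop (𝓝 0) := by
  have h1 := hz.comp (tendsto_add_atTop_nat 1)
  have h2 : Tendsto (fun T : ℕ => 1 + 1 / (T : ℝ)) atTop (𝓝 (1 + 0)) :=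
    tendsto_const_nhds.add tendsto_one_div_atTop_nhds_zero_nat
  have h3 := (h2.mul h1).sub hz
  rw [show (1 + 0) * S - S = 0 by ring] at h3
  refine h3.congr' ?_
  filter_upwards [eventually_gt_atTop 0] with T hT
  have hT' : (T : ℝ) ≠ 0 := by positivity
  simp only [Function.comp, Finset.sum_range_succ]
  push_cast
  have : (T : ℝ) + 1 ≠ 0 := by positivity
  field_simp
  ring

/-- Convergence of the quadratic means makes the rescaled array uniformly small. -/
lemma eventually_forall_abs_div_sqrt_lt
    (hz : Tendsto (fun T : ℕ => (T : ℝ)⁻¹ * ∑ t ∈ Finset.range T, z t ^ 2) atTop (𝓝 S))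
    {δ : ℝ} (hδ : 0 < δ) : ∀ᶠ T : ℕ in atTop, ∀ t < T, |z t / √(T : ℝ)| < δ := by
  have h1 := (tendsto_sq_div_nat hz).eventually (gt_mem_nhds (by positivity : 0 < δ ^ 2))
  obtain ⟨N, hN⟩ := eventually_atTop.1 (h1.and (eventually_gt_atTop 0))
  have h2 : ∀ᶠ T : ℕ in atTop, ∀ t ∈ Finset.range N, z t ^ 2 < δ ^ 2 * T := by
    rw [Filter.eventually_all_finset]
    intro t _
    exact (tendsto_natCast_atTop_atTop.const_mul_atTop (by positivity)).eventually_gt_atTop _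
  filter_upwards [h2, eventually_gt_atTop 0] with T hT hT0 t ht
  have hT0' : (0 : ℝ) < T := by positivity
  rw [← Real.sqrt_sq_eq_abs, Real.sqrt_lt' hδ, div_pow, Real.sq_sqrt hT0'.le, div_lt_iff₀ hT0']
  rcases lt_or_ge t N with h | h
  · exact hT t (Finset.mem_range.2 h)
  · obtain ⟨h3, h4⟩ := hN t h
    rw [div_lt_iff₀ (by positivity)] at h3
    refine h3.trans ?_
    gcongr

lemma tendsto_sum_isLittleO_zero {G : Type*} [NormedAddCommGroup G] {f : ℝ → G}
    (hz : Tendsto (fun T : ℕ => (T : ℝ)⁻¹ * ∑ t ∈ Finset.range T, z t ^ 2) atTop (𝓝 S))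
    (hf : f =o[𝓝 0] fun h : ℝ => h ^ 2) :
    Tendsto (fun T : ℕ => ∑ t ∈ Finset.range T, ‖f (z t / √(T : ℝ))‖) atTop (𝓝 0) := by
  rw [Metric.tendsto_nhds]
  intro e he
  set c : ℝ := e / (2 * (|S| + 1)) with hc
  have hc0 : 0 < c := by positivity
  obtain ⟨δ, hδ, hfδ⟩ := Metric.eventually_nhds_iff.1 (hf.def hc0)
  have hS : ∀ᶠ T : ℕ in atTop, (T : ℝ)⁻¹ * ∑ t ∈ Finset.range T, z t ^ 2 < |S| + 1 :=
    hz.eventually (gt_mem_nhds (by linarith [le_abs_self S]))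
  filter_upwards [eventually_forall_abs_div_sqrt_lt hz hδ, hS] with T hT hST
  rw [Real.dist_eq, sub_zero, abs_of_nonneg (Finset.sum_nonneg fun _ _ => norm_nonneg _)]
  calc ∑ t ∈ Finset.range T, ‖f (z t / √(T : ℝ))‖
      ≤ ∑ t ∈ Finset.range T, c * (z t / √(T : ℝ)) ^ 2 := by
        refine Finset.sum_le_sum fun t ht => ?_
        have := hfδ (y := z t / √(T : ℝ)) (by
          rw [Real.dist_eq, sub_zero]; exact hT t (Finset.mem_range.1 ht))
        rwa [Real.norm_of_nonneg (sq_nonneg _)] at this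
    _ = c * ((T : ℝ)⁻¹ * ∑ t ∈ Finset.range T, z t ^ 2) := by
        rw [← Finset.mul_sum, sum_div_sqrt_sq]
    _ ≤ c * (|S| + 1) := by gcongr
    _ = e / 2 := by rw [hc]; field_simp
    _ < e := by linarith

lemma tendsto_sum_of_isLittleO {f : ℝ → ℝ} {a : ℝ}
    (hz : Tendsto (fun T : ℕ => (T : ℝ)⁻¹ * ∑ t ∈ Finset.range T, z t ^ 2) atTop (𝓝 S))
    (hf : (fun h => f h - a * h ^ 2) =o[𝓝 0] fun h : ℝ => h ^ 2) :
    Tendsto (fun T : ℕ => ∑ t ∈ Finset.range T, f (z t / √(T : ℝ))) atTop (𝓝 (a * S)) := by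
  have h1 : Tendsto (fun T : ℕ => ∑ t ∈ Finset.range T,
      (f (z t / √(T : ℝ)) - a * (z t / √(T : ℝ)) ^ 2)) atTop (𝓝 0) := by
    refine squeeze_zero_norm (fun T => ?_) (tendsto_sum_isLittleO_zero hz hf)
    exact norm_sum_le _ _
  have h2 := h1.add (hz.const_mul a)
  rw [zero_add] at h2
  refine h2.congr fun T => ?_
  rw [Finset.sum_sub_distrib, ← Finset.mul_sum, sum_div_sqrt_sq]
  ring

end Array

/-! ### A central limit theorem for weighted sums -/

lemma norm_prod_sub_prod_le {ι : Type*} (s : Finset ι) (a b : ι → ℂ) (ha : ∀ i, ‖a i‖ ≤ 1)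
    (hb : ∀ i, ‖b i‖ ≤ 1) : ‖∏ i ∈ s, a i - ∏ i ∈ s, b i‖ ≤ ∑ i ∈ s, ‖a i - b i‖ := by
  classical
  induction s using Finset.induction_on with
  | empty => simp
  | insert i s hi ih =>
    rw [Finset.prod_insert hi, Finset.prod_insert hi, Finset.sum_insert hi]
    have e : a i * ∏ j ∈ s, a j - b i * ∏ j ∈ s, b j =
        (a i - b i) * ∏ j ∈ s, a j + b i * (∏ j ∈ s, a j - ∏ j ∈ s, b j) := by ring
    have h1 : ‖∏ j ∈ s, a j‖ ≤ 1 := by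
      rw [norm_prod]; exact Finset.prod_le_one (fun _ _ => norm_nonneg _) fun j _ => ha j
    rw [e]
    refine (norm_add_le _ _).trans (add_le_add ?_ ?_)
    · rw [norm_mul]; exact mul_le_of_le_one_right (norm_nonneg _) h1
    · rw [norm_mul]; exact (mul_le_of_le_one_left (norm_nonneg _) (hb i)).trans ih

/-- To second order the characteristic function of a centred law agrees with the Gaussian one. -/
lemma charFun_sub_exp_isLittleO {μ : Measure ℝ} [IsProbabilityMeasure μ] (h2 : MemLp id 2 μ)
    (h0 : ∫ x, x ∂μ = 0) :
    (fun h : ℝ => charFun μ h - Complex.exp (-((∫ x, x ^ 2 ∂μ : ℝ) : ℂ) / 2 * (h : ℂ) ^ 2))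
      =o[𝓝 0] fun h : ℝ => h ^ 2 := by
  set v : ℝ := ∫ x, x ^ 2 ∂μ with hv
  have h1 : (fun h : ℝ => charFun μ h - (1 - (v : ℂ) * (h : ℂ) ^ 2 / 2)) =o[𝓝 0]
      fun h : ℝ => h ^ 2 := by
    have hT : ∀ h : ℝ, taylorWithinEval (charFun μ) 2 Set.univ 0 h =
        1 - (v : ℂ) * (h : ℂ) ^ 2 / 2 := fun h => by
      have := taylorWithinEval_charFun_two_zero (P := μ) (X := id) aemeasurable_id
        (by rwa [Measure.map_id]) h
      rw [Measure.map_id] at this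
      rw [this]
      simp [h0, hv]
    simp_rw [← hT]
    have := taylor_isLittleO_univ (f := charFun μ) (n := 2) (x₀ := 0)
      (contDiff_charFun (by simpa using h2))
    simpa using this
  have h3 : (fun h : ℝ => Complex.exp (-(v : ℂ) / 2 * (h : ℂ) ^ 2) - 1 -
      (-(v : ℂ) / 2 * (h : ℂ) ^ 2)) =o[𝓝 0] fun h : ℝ => h ^ 2 := by
    have hd : (fun w : ℂ => Complex.exp w - 1 - w) =o[𝓝 0] fun w : ℂ => w := by
      have := (Complex.hasDerivAt_exp 0)
      rw [hasDerivAt_iff_isLittleO] at this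
      simpa using this
    have ht : Tendsto (fun h : ℝ => -(v : ℂ) / 2 * (h : ℂ) ^ 2) (𝓝 0) (𝓝 0) := by
      have hc : Continuous fun h : ℝ => -(v : ℂ) / 2 * (h : ℂ) ^ 2 := by fun_prop
      simpa using hc.tendsto 0
    refine (hd.comp_tendsto ht).trans_isBigO ?_
    refine Asymptotics.IsBigO.of_bound ‖-(v : ℂ) / 2‖ (Eventually.of_forall fun h => ?_)
    simp
  have h4 := h1.sub h3
  refine h4.congr_left fun h => ?_
  ring

/-- Lindeberg-type central limit theorem, on the level of characteristic functions, for
`T ^ (-1/2) ∑ z t ξ t` with `ξ t` i.i.d. and deterministic weights `z t`. -/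
lemma tendsto_prod_charFun {μ : Measure ℝ} [IsProbabilityMeasure μ] (h2 : MemLp id 2 μ)
    (h0 : ∫ x, x ∂μ = 0) {z : ℕ → ℝ} {S : ℝ}
    (hz : Tendsto (fun T : ℕ => (T : ℝ)⁻¹ * ∑ t ∈ Finset.range T, z t ^ 2) atTop (𝓝 S)) :
    Tendsto (fun T : ℕ => ∏ t ∈ Finset.range T, charFun μ (z t / √(T : ℝ))) atTop
      (𝓝 (Complex.exp (-((∫ x, x ^ 2 ∂μ : ℝ) : ℂ) / 2 * (S : ℂ)))) := by
  set v : ℝ := ∫ x, x ^ 2 ∂μ with hv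
  have hv0 : 0 ≤ v := integral_nonneg fun x => sq_nonneg x
  have hnorm : ∀ h : ℝ, ‖Complex.exp (-(v : ℂ) / 2 * (h : ℂ) ^ 2)‖ ≤ 1 := fun h => by
    rw [Complex.norm_exp]
    have : (-(v : ℂ) / 2 * (h : ℂ) ^ 2).re = -(v / 2 * h ^ 2) := by
      rw [show (-(v : ℂ) / 2 * (h : ℂ) ^ 2) = ((-(v / 2 * h ^ 2) : ℝ) : ℂ) by push_cast; ring]
      exact Complex.ofReal_re _
    rw [this, Real.exp_le_one_iff]
    have : 0 ≤ v / 2 * h ^ 2 := by positivity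
    linarith
  set g : ℝ → ℂ := fun h => Complex.exp (-(v : ℂ) / 2 * (h : ℂ) ^ 2) with hg
  have h1 : Tendsto (fun T : ℕ => ∏ t ∈ Finset.range T, charFun μ (z t / √(T : ℝ)) -
      ∏ t ∈ Finset.range T, g (z t / √(T : ℝ))) atTop (𝓝 0) := by
    refine squeeze_zero_norm (fun T => ?_)
      (tendsto_sum_isLittleO_zero hz (charFun_sub_exp_isLittleO h2 h0))
    exact norm_prod_sub_prod_le _ _ _ (fun t => norm_charFun_le_one _) fun t => hnorm _
  have h3 : Tendsto (fun T : ℕ => ∏ t ∈ Finset.range T, g (z t / √(T : ℝ))) atTop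
      (𝓝 (Complex.exp (-(v : ℂ) / 2 * (S : ℂ)))) := by
    have hc : Continuous fun S : ℝ => Complex.exp (-(v : ℂ) / 2 * (S : ℂ)) := by fun_prop
    refine ((hc.tendsto S).comp hz).congr fun T => ?_
    have e : ∏ t ∈ Finset.range T, g (z t / √(T : ℝ)) =
        Complex.exp (-(v : ℂ) / 2 * ((∑ t ∈ Finset.range T, (z t / √(T : ℝ)) ^ 2 : ℝ) : ℂ)) := by
      rw [Complex.ofReal_sum, Finset.mul_sum, Complex.exp_sum]
      exact Finset.prod_congr rfl fun t _ => by rw [hg, Complex.ofReal_pow]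
    rw [e, sum_div_sqrt_sq]
    rfl
  have h4 := h1.add h3
  rw [zero_add] at h4
  exact h4.congr fun T => sub_add_cancel _ _

/-! ### Convex functions: uniform approximation and minimisers -/

section Convex

variable {ι : Type*} [Fintype ι]

lemma exists_finset_closedBall_subset_convexHull {R : ℝ} (hR : 0 ≤ R) :
    ∃ V : Finset (ι → ℝ), Metric.closedBall (0 : ι → ℝ) R ⊆ convexHull ℝ (V : Set (ι → ℝ)) := by
  classical
  refine ⟨Fintype.piFinset fun _ => {-R, R}, ?_⟩
  rw [Fintype.coe_piFinset, convexHull_pi, closedBall_pi _ hR]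
  refine Set.pi_mono fun i _ => ?_
  rw [Finset.coe_pair, convexHull_pair, segment_eq_Icc (by linarith), Real.closedBall_eq_Icc]
  simp

/-- A nonnegative convex function bounded by `M` on a ball of radius `R + 2` is `2 M`-Lipschitz on
the ball of radius `R`. -/
lemma abs_sub_le_of_convexOn {g : (ι → ℝ) → ℝ} (hg : ConvexOn ℝ Set.univ g) (hg0 : ∀ θ, 0 ≤ g θ)
    {R M : ℝ} (hM : ∀ θ, ‖θ‖ ≤ R + 2 → g θ ≤ M) {θ θ' : ι → ℝ} (hθ : ‖θ‖ ≤ R) (hθ' : ‖θ'‖ ≤ R) :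
    |g θ - g θ'| ≤ 2 * M * ‖θ - θ'‖ := by
  have hM0 : 0 ≤ M := (hg0 θ).trans (hM θ (by linarith))
  have h1 : ConvexOn ℝ (Metric.ball (0 : ι → ℝ) (R + 2)) g :=
    hg.subset (Set.subset_univ _) (convex_ball _ _)
  have h2 := h1.lipschitzOnWith_of_abs_le one_pos (M := M) fun a ha => by
    rw [abs_of_nonneg (hg0 a)]
    exact hM a (by simpa using ha.le)
  have h3 := h2.dist_le_mul θ (by rw [mem_ball_zero_iff]; linarith) θ'
    (by rw [mem_ball_zero_iff]; linarith)
  rwa [Real.dist_eq, dist_eq_norm, div_one, Real.coe_toNNReal _ (by positivity)] at h3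

/-- For nonnegative convex functions, closeness to a continuous function on a suitable finite set
forces uniform closeness on a ball. -/
lemma exists_finset_forall_convexOn {q : (ι → ℝ) → ℝ} (hq : Continuous q) {R ρ : ℝ} (hR : 0 ≤ R)
    (hρ : 0 < ρ) :
    ∃ (F : Finset (ι → ℝ)) (δ : ℝ), 0 < δ ∧ ∀ g : (ι → ℝ) → ℝ, ConvexOn ℝ Set.univ g →
      (∀ θ, 0 ≤ g θ) → (∀ θ ∈ F, |g θ - q θ| ≤ δ) → ∀ θ, ‖θ‖ ≤ R → |g θ - q θ| ≤ ρ := by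
  classical
  obtain ⟨V, hV⟩ := exists_finset_closedBall_subset_convexHull (ι := ι) (by linarith : 0 ≤ R + 2)
  set M : ℝ := ∑ v ∈ V, |q v| + 1 with hM
  have hM0 : 0 < M := by
    have : 0 ≤ ∑ v ∈ V, |q v| := Finset.sum_nonneg fun _ _ => abs_nonneg _
    linarith
  have hK : IsCompact (Metric.closedBall (0 : ι → ℝ) R) := isCompact_closedBall _ _
  obtain ⟨e₁, he₁, hqe⟩ := Metric.uniformContinuousOn_iff.1
    (hK.uniformContinuousOn_of_continuous hq.continuousOn) (ρ / 3) (by positivity)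
  set e : ℝ := min e₁ (ρ / (6 * M)) with he
  have he0 : 0 < e := lt_min he₁ (by positivity)
  obtain ⟨N, hNs, hNf, hN⟩ := hK.finite_cover_balls he0
  refine ⟨V ∪ hNf.toFinset, min 1 (ρ / 3), lt_min one_pos (by positivity), fun g hg hg0 hF θ hθ => ?_⟩
  have hgM : ∀ θ, ‖θ‖ ≤ R + 2 → g θ ≤ M := fun θ hθ => by
    obtain ⟨v, hv, hle⟩ := (hg.subset (Set.subset_univ _)
      (convex_convexHull ℝ _)).exists_ge_of_mem_convexHull (subset_convexHull ℝ (V : Set (ι → ℝ)))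
      (hV (by simpa using hθ))
    have h1 := (abs_le.1 (hF v (Finset.mem_union_left _ hv))).2
    have h2 : |q v| ≤ ∑ v ∈ V, |q v| :=
      Finset.single_le_sum (f := fun v => |q v|) (fun _ _ => abs_nonneg _) hv
    have h3 := le_abs_self (q v)
    have h4 : min 1 (ρ / 3) ≤ 1 := min_le_left _ _
    linarith
  obtain ⟨n, hn, hnθ⟩ := Set.mem_iUnion₂.1 (hN (by simpa using hθ : θ ∈ Metric.closedBall 0 R))
  have hnR : ‖n‖ ≤ R := by simpa using hNs hn
  rw [Metric.mem_ball] at hnθ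
  have h1 : |g θ - g n| ≤ ρ / 3 := by
    refine (abs_sub_le_of_convexOn hg hg0 hgM hθ hnR).trans ?_
    rw [← dist_eq_norm]
    calc 2 * M * dist θ n ≤ 2 * M * (ρ / (6 * M)) := by
          gcongr; exact hnθ.le.trans (min_le_right _ _)
      _ = ρ / 3 := by field_simp; norm_num
  have h2 : |g n - q n| ≤ ρ / 3 :=
    (hF n (Finset.mem_union_right _ (by simpa using hn))).trans (min_le_right _ _)
  have h3 : |q θ - q n| ≤ ρ / 3 := by
    rw [← Real.dist_eq]
    exact (hqe θ (by simpa using hθ) n (hNs hn) (hnθ.trans_le (min_le_left _ _))).le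
  rw [abs_le] at *
  constructor <;> linarith [h1.1, h1.2, h2.1, h2.2, h3.1, h3.2]

/-- A convex function that vanishes at the origin and is positive on the part of a sphere in `S` can
be nonpositive only at points of `S` inside that sphere. -/
lemma norm_le_of_convexOn {E : Type*} [NormedAddCommGroup E] [NormedSpace ℝ E] {S : Set E}
    {F : E → ℝ} (hF : ConvexOn ℝ S F) (h0S : (0 : E) ∈ S) (h0 : F 0 = 0) {r : ℝ} (hr : 0 < r)
    (hpos : ∀ θ ∈ S, ‖θ‖ = r → 0 < F θ) {θ : E} (hθ : θ ∈ S) (hle : F θ ≤ 0) : ‖θ‖ ≤ r := by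
  by_contra! hlt
  have hn : 0 < ‖θ‖ := hr.trans hlt
  have ha0 : 0 ≤ r / ‖θ‖ := by positivity
  have ha1 : 0 ≤ 1 - r / ‖θ‖ := by
    rw [sub_nonneg, div_le_one hn]; exact hlt.le
  have hmem := hF.1 hθ h0S ha0 ha1 (by ring)
  have hval := hF.2 hθ h0S ha0 ha1 (by ring)
  rw [smul_zero, add_zero] at hmem hval
  rw [h0, smul_zero, add_zero, smul_eq_mul] at hval
  have hnorm : ‖(r / ‖θ‖) • θ‖ = r := by
    rw [norm_smul, Real.norm_of_nonneg ha0]; field_simp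
  have := hpos _ hmem hnorm
  nlinarith [mul_nonneg ha0 (neg_nonneg.2 hle)]

end Convex

/-! ### Chebyshev bounds for sums of functions of the errors -/

section Chebyshev

variable {Ω : Type*} [MeasurableSpace Ω] {P : Measure Ω} [IsProbabilityMeasure P] {ν : Measure ℝ}
  {ε : ℕ → Ω → ℝ}

lemma measure_abs_sum_sub_ge_le (hlaw : ∀ t, HasLaw (ε t) ν P) (hindep : iIndepFun ε P)
    {f : ℕ → ℝ → ℝ} (hf : ∀ t, Measurable (f t)) (hf2 : ∀ t, MemLp (f t) 2 ν) (T : ℕ) {c : ℝ}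
    (hc : 0 < c) :
    P {ω | c ≤ |∑ t ∈ Finset.range T, f t (ε t ω) - ∑ t ∈ Finset.range T, ∫ s, f t s ∂ν|} ≤
      ENNReal.ofReal ((∑ t ∈ Finset.range T, ∫ s, f t s ^ 2 ∂ν) / c ^ 2) := by
  have hmem : ∀ t, MemLp (f t ∘ ε t) 2 P := fun t => by
    have := hf2 t
    rw [← (hlaw t).map_eq] at this
    exact this.comp_of_map (hlaw t).aemeasurable
  have hint : ∀ t, ∫ ω, (f t ∘ ε t) ω ∂P = ∫ s, f t s ∂ν := fun t =>
    (hlaw t).integral_comp (hf t).aestronglyMeasurable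
  have hsum : MemLp (∑ t ∈ Finset.range T, f t ∘ ε t) 2 P :=
    memLp_finsetSum' _ fun t _ => hmem t
  have hmean : ∫ ω, (∑ t ∈ Finset.range T, f t ∘ ε t) ω ∂P =
      ∑ t ∈ Finset.range T, ∫ s, f t s ∂ν := by
    simp only [Finset.sum_apply]
    rw [integral_finsetSum _ fun t _ => (hmem t).integrable one_le_two]
    exact Finset.sum_congr rfl fun t _ => hint t
  have hvar : variance (∑ t ∈ Finset.range T, f t ∘ ε t) P ≤
      ∑ t ∈ Finset.range T, ∫ s, f t s ^ 2 ∂ν := by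
    rw [IndepFun.variance_sum (fun t _ => hmem t) fun i _ j _ hij =>
      (hindep.indepFun hij).comp (hf i) (hf j)]
    refine Finset.sum_le_sum fun t _ => ?_
    refine (variance_le_expectation_sq (hmem t).aestronglyMeasurable).trans_eq ?_
    exact (hlaw t).integral_comp (f := fun s => f t s ^ 2)
      ((hf t).pow_const 2).aestronglyMeasurable
  have h := meas_ge_le_variance_div_sq hsum hc
  rw [hmean] at h
  simp only [Finset.sum_apply, Function.comp] at h
  refine h.trans (ENNReal.ofReal_le_ofReal ?_)
  gcongr

/-- The remainder sum of one quantile level converges in probability to its quadratic limit. -/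
lemma tendsto_measure_sum_rem (hlaw : ∀ t, HasLaw (ε t) ν P) (hindep : iIndepFun ε P)
    {p τ b : ℝ} (hp : 1 < p) (hp2 : p ≤ 2) (hτ0 : 0 ≤ τ) (hτ1 : τ ≤ 1)
    (hint : Integrable (fun s => |s - b| ^ (p - 2)) ν)
    (hne : ∀ᵐ s ∂ν, s ≠ b ∨ (p = 2 ∧ τ = 1 / 2)) {z : ℕ → ℝ} {S : ℝ}
    (hz : Tendsto (fun T : ℕ => (T : ℝ)⁻¹ * ∑ t ∈ Finset.range T, z t ^ 2) atTop (𝓝 S))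
    {c : ℝ} (hc : 0 < c) :
    Tendsto (fun T : ℕ => P {ω | c ≤ |∑ t ∈ Finset.range T, rem p τ (ε t ω - b) (z t / √(T : ℝ)) -
      (∫ s, psi p τ (s - b) ∂ν) / 2 * S|}) atTop (𝓝 0) := by
  have : IsProbabilityMeasure ν := (hlaw 0).isProbabilityMeasure_iff.1 inferInstance
  have h1 := tendsto_sum_of_isLittleO hz (integral_rem_isLittleO hp hp2 hτ0 hτ1 hint hne)
  have h2 := tendsto_sum_of_isLittleO (a := 0) hz
    (by simpa using integral_rem_sq_isLittleO hp hp2 hτ0 hτ1 hint hne)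
  have h3 : Tendsto (fun T : ℕ => ENNReal.ofReal ((∑ t ∈ Finset.range T,
      ∫ s, rem p τ (s - b) (z t / √(T : ℝ)) ^ 2 ∂ν) / (c / 2) ^ 2)) atTop (𝓝 0) := by
    have := ENNReal.tendsto_ofReal (h2.div_const ((c / 2) ^ 2))
    simpa using this
  have h4 := (Metric.tendsto_nhds.1 h1) (c / 2) (by positivity)
  refine tendsto_of_tendsto_of_tendsto_of_le_of_le' tendsto_const_nhds h3
    (Eventually.of_forall fun _ => zero_le) ?_
  filter_upwards [h4] with T hT
  refine le_trans (measure_mono fun ω hω => ?_) (measure_abs_sum_sub_ge_le hlaw hindep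
    (f := fun t s => rem p τ (s - b) (z t / √(T : ℝ)))
    (fun t => (measurable_rem hp hτ0 hτ1 _).comp (measurable_id.sub_const b))
    (fun t => memLp_rem hp hp2 hτ0 hτ1 b _ 2) T (half_pos hc))
  simp only [Set.mem_ofPred_eq] at hω ⊢
  rw [Real.dist_eq] at hT
  have := abs_sub_le (∑ t ∈ Finset.range T, rem p τ (ε t ω - b) (z t / √(T : ℝ)))
    (∑ t ∈ Finset.range T, ∫ s, rem p τ (s - b) (z t / √(T : ℝ)) ∂ν)
    ((∫ s, psi p τ (s - b) ∂ν) / 2 * S)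
  linarith

/-- Normalised weighted sums of centred square integrable functions of the errors are bounded in
probability. -/
lemma exists_eventually_measure_abs_sum_le (hlaw : ∀ t, HasLaw (ε t) ν P)
    (hindep : iIndepFun ε P) {g : ℝ → ℝ} (hg : Measurable g) (hg2 : MemLp g 2 ν)
    (hg0 : ∫ s, g s ∂ν = 0) {z : ℕ → ℝ} {S : ℝ}
    (hz : Tendsto (fun T : ℕ => (T : ℝ)⁻¹ * ∑ t ∈ Finset.range T, z t ^ 2) atTop (𝓝 S))
    {η : ℝ} (hη : 0 < η) :
    ∃ M : ℝ, ∀ᶠ T : ℕ in atTop,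
      P {ω | M ≤ |∑ t ∈ Finset.range T, g (ε t ω) * (z t / √(T : ℝ))|} ≤ ENNReal.ofReal η := by
  set v : ℝ := ∫ s, g s ^ 2 ∂ν with hv
  have hv0 : 0 ≤ v := integral_nonneg fun s => sq_nonneg _
  set B : ℝ := v * (|S| + 1) with hB
  have hB0 : 0 ≤ B := by positivity
  have hM : 0 < √(B / η) + 1 := by positivity
  refine ⟨√(B / η) + 1, ?_⟩
  have hS : ∀ᶠ T : ℕ in atTop, (T : ℝ)⁻¹ * ∑ t ∈ Finset.range T, z t ^ 2 < |S| + 1 :=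
    hz.eventually (gt_mem_nhds (by linarith [le_abs_self S]))
  filter_upwards [hS] with T hT
  have h := measure_abs_sum_sub_ge_le hlaw hindep (f := fun t s => g s * (z t / √(T : ℝ)))
    (fun t => hg.mul_const _) (fun t => by simpa [mul_comm] using hg2.const_mul (z t / √(T : ℝ)))
    T hM
  simp only [integral_mul_const, hg0, zero_mul, Finset.sum_const_zero, sub_zero, mul_pow] at h
  refine h.trans (ENNReal.ofReal_le_ofReal ?_)
  rw [← Finset.mul_sum, sum_div_sqrt_sq, div_le_iff₀ (by positivity)]
  have h1 : v * ((T : ℝ)⁻¹ * ∑ t ∈ Finset.range T, z t ^ 2) ≤ B := by rw [hB]; gcongr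
  have h2 : B / η ≤ (√(B / η) + 1) ^ 2 := by
    have := Real.sq_sqrt (by positivity : 0 ≤ B / η)
    nlinarith [Real.sqrt_nonneg (B / η)]
  rw [div_le_iff₀ hη] at h2
  linarith

/-- Central limit theorem for weighted sums of centred functions of i.i.d. errors, with
deterministic vector weights. -/
lemma tendstoInDistribution_weighted_sum {κ : Type*} [Fintype κ] [DecidableEq κ]
    (hlaw : ∀ t, HasLaw (ε t) ν P) (hindep : iIndepFun ε P) {g : ℝ → ℝ} (hg : Measurable g)
    (hg2 : MemLp g 2 ν) (hg0 : ∫ s, g s ∂ν = 0) {w : ℕ → κ → ℝ} {G : Matrix κ κ ℝ}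
    (hG : G.PosSemidef)
    (hw : ∀ s : κ → ℝ, Tendsto (fun T : ℕ => (T : ℝ)⁻¹ * ∑ t ∈ Finset.range T, (s ⬝ᵥ w t) ^ 2) atTop
      (𝓝 (s ⬝ᵥ G *ᵥ s))) :
    TendstoInDistribution (fun (T : ℕ) ω => WithLp.toLp 2
        (∑ t ∈ Finset.range T, (g (ε t ω) / √(T : ℝ)) • w t)) atTop id (fun _ => P)
      (multivariateGaussian 0 ((∫ s, g s ^ 2 ∂ν) • G)) := by
  have : IsProbabilityMeasure ν := (hlaw 0).isProbabilityMeasure_iff.1 inferInstance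
  have hgε : ∀ t, AEMeasurable (fun ω => g (ε t ω)) P := fun t =>
    hg.comp_aemeasurable (hlaw t).aemeasurable
  have hmeas : ∀ T : ℕ, AEMeasurable (fun ω => WithLp.toLp 2
      (∑ t ∈ Finset.range T, (g (ε t ω) / √(T : ℝ)) • w t)) P := fun T => by
    refine (WithLp.measurable_toLp 2 (κ → ℝ)).comp_aemeasurable ?_
    refine aemeasurable_pi_lambda _ fun j => ?_
    simp only [Finset.sum_apply, Pi.smul_apply, smul_eq_mul]
    exact Finset.aemeasurable_fun_sum _ fun t _ =>
      ((hgε t).div_const _).mul_const _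
  refine ⟨hmeas, aemeasurable_id, ?_⟩
  refine ProbabilityMeasure.tendsto_iff_tendsto_charFun.2 fun s => ?_
  have hv0 : 0 ≤ ∫ s, g s ^ 2 ∂ν := integral_nonneg fun s => sq_nonneg _
  simp only [ProbabilityMeasure.coe_mk, Measure.map_id]
  rw [charFun_multivariateGaussian (hG.smul hv0)]
  have hμ : IsProbabilityMeasure (ν.map g) := Measure.isProbabilityMeasure_map hg.aemeasurable
  have h2 : MemLp id 2 (ν.map g) := by
    rw [memLp_map_measure_iff aestronglyMeasurable_id hg.aemeasurable]; exact hg2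
  have h0 : ∫ x, x ∂(ν.map g) = 0 := by
    rw [integral_map (f := fun x : ℝ => x) hg.aemeasurable aestronglyMeasurable_id, hg0]
  have h3 : ∫ x, x ^ 2 ∂(ν.map g) = ∫ s, g s ^ 2 ∂ν :=
    integral_map hg.aemeasurable (by fun_prop)
  have key := tendsto_prod_charFun h2 h0 (hw s)
  rw [h3] at key
  convert! key using 1
  · ext T
    have h4 : ∀ t, charFun (ν.map g) ((s.ofLp ⬝ᵥ w t) / √(T : ℝ)) =
        charFun (P.map (fun ω => g (ε t ω))) ((s.ofLp ⬝ᵥ w t) / √(T : ℝ)) := fun t => by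
      rw [← (hlaw t).map_eq, AEMeasurable.map_map_of_aemeasurable hg.aemeasurable
        (hlaw t).aemeasurable]
      rfl
    have h5 : ∀ t, charFun (P.map (fun ω => g (ε t ω))) ((s.ofLp ⬝ᵥ w t) / √(T : ℝ)) =
        charFun (P.map (fun ω => (s.ofLp ⬝ᵥ w t) / √(T : ℝ) * g (ε t ω))) 1 := fun t => by
      rw [charFun_map_mul_comp (hgε t), mul_one]
    simp_rw [h4, h5]
    rw [← Finset.prod_apply, ← iIndepFun.charFun_map_fun_finsetSum_eq_prod (s := Finset.range T)
      (fun t _ => (hgε t).const_mul _)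
      ((hindep.comp (fun t x => (s.ofLp ⬝ᵥ w t) / √(T : ℝ) * g x)
        (fun t => hg.const_mul _)).restrict _)]
    rw [charFun_apply, charFun_apply, integral_map (hmeas T) (by fun_prop), integral_map
      (Finset.aemeasurable_fun_sum _ fun t _ =>
        (hgε t).const_mul _) (by fun_prop)]
    refine integral_congr_ae (Eventually.of_forall fun ω => ?_)
    have e : inner ℝ (WithLp.toLp 2 (∑ t ∈ Finset.range T, (g (ε t ω) / √(T : ℝ)) • w t)) s =
        ∑ t ∈ Finset.range T, (s.ofLp ⬝ᵥ w t) / √(T : ℝ) * g (ε t ω) := by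
      rw [EuclideanSpace.inner_eq_star_dotProduct, star_trivial, dotProduct_sum]
      refine Finset.sum_congr rfl fun t _ => ?_
      rw [dotProduct_smul, smul_eq_mul]; ring
    simp only
    rw [e]
    simp
  · congr 1
    rw [inner_zero_right, smul_mulVec, dotProduct_smul, smul_eq_mul]
    congr 1
    push_cast
    ring

end Chebyshev

/-! ### Local parametrisation of the criterion -/

section Local

variable {m K : ℕ}

/-- The linear form by which the local parameter `θ = (u, v)` shifts the residual of observation `t`
at level `k`: `u k + x t ⬝ᵥ v`. -/
def shift (x : ℕ → Fin m → ℝ) (k : Fin K) (θ : Fin K ⊕ Fin m → ℝ) (t : ℕ) : ℝ :=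
  θ (.inl k) + x t ⬝ᵥ (θ ∘ Sum.inr)

/-- The second-order part of the rescaled criterion, as a function of the local parameter, for the
error sequence `e`. -/
noncomputable def remSum (p : ℝ) (τ : Fin K → ℝ) (x : ℕ → Fin m → ℝ) (b : Fin K → ℝ) (T : ℕ)
    (e : ℕ → ℝ) (θ : Fin K ⊕ Fin m → ℝ) : ℝ :=
  ∑ k, ∑ t ∈ Finset.range T, rem p (τ k) (e t - b k) (shift x k θ t / √(T : ℝ))

/-- The sum over the levels of the derivatives of the losses. -/
noncomputable def totalPhi (p : ℝ) (τ b : Fin K → ℝ) (s : ℝ) : ℝ := ∑ k, phi p (τ k) (s - b k)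

/-- The first-order part of the rescaled criterion: minus its gradient at the true parameter. -/
noncomputable def score (p : ℝ) (τ : Fin K → ℝ) (x : ℕ → Fin m → ℝ) (b : Fin K → ℝ) (T : ℕ)
    (e : ℕ → ℝ) : Fin K ⊕ Fin m → ℝ :=
  Sum.elim (fun k => ∑ t ∈ Finset.range T, phi p (τ k) (e t - b k) * (1 / √(T : ℝ)))
    (fun j => ∑ t ∈ Finset.range T, totalPhi p τ b (e t) * (x t j / √(T : ℝ)))

/-- The limit of `remSum`, where `a k` is the curvature of the expected loss at level `k`. -/
noncomputable def limitQuad (a : Fin K → ℝ) (C : Matrix (Fin m) (Fin m) ℝ)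
    (θ : Fin K ⊕ Fin m → ℝ) : ℝ :=
  ∑ k, a k / 2 * (θ (.inl k) ^ 2 + (θ ∘ Sum.inr) ⬝ᵥ C *ᵥ (θ ∘ Sum.inr))

lemma score_dotProduct (p : ℝ) (τ : Fin K → ℝ) (x : ℕ → Fin m → ℝ) (b : Fin K → ℝ) (T : ℕ)
    (e : ℕ → ℝ) (θ : Fin K ⊕ Fin m → ℝ) :
    score p τ x b T e ⬝ᵥ θ =
      ∑ k, ∑ t ∈ Finset.range T, phi p (τ k) (e t - b k) * (shift x k θ t / √(T : ℝ)) := by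
  have h1 : ∀ k t, phi p (τ k) (e t - b k) * (shift x k θ t / √(T : ℝ)) =
      phi p (τ k) (e t - b k) * (1 / √(T : ℝ)) * θ (.inl k) +
        ∑ j, phi p (τ k) (e t - b k) * (x t j / √(T : ℝ)) * θ (.inr j) := fun k t => by
    rw [shift, dotProduct, add_div, mul_add, Finset.sum_div, Finset.mul_sum]
    congr 1
    · ring
    · refine Finset.sum_congr rfl fun j _ => ?_
      simp only [Function.comp]; ring
  simp_rw [h1, Finset.sum_add_distrib]
  rw [dotProduct, Fintype.sum_sum_type]
  congr 1
  · refine Finset.sum_congr rfl fun k _ => ?_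
    rw [score, Sum.elim_inl, Finset.sum_mul]
  · rw [Finset.sum_comm (s := Finset.univ (α := Fin K))]
    simp_rw [Finset.sum_comm (s := Finset.univ (α := Fin K)) (t := Finset.univ (α := Fin m))]
    rw [Finset.sum_comm]
    refine Finset.sum_congr rfl fun j _ => ?_
    rw [score, Sum.elim_inr, Finset.sum_mul]
    refine Finset.sum_congr rfl fun t _ => ?_
    rw [totalPhi, Finset.sum_mul, Finset.sum_mul]

/-- The criterion in local coordinates splits into its quadratic and its linear part. -/
lemma objective_sub (p : ℝ) (τ : Fin K → ℝ) (x : ℕ → Fin m → ℝ) (b : Fin K → ℝ) (β : Fin m → ℝ)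
    (y : ℕ → ℝ) (e : ℕ → ℝ) (hy : ∀ t, y t = x t ⬝ᵥ β + e t) (T : ℕ)
    (θ : Fin K ⊕ Fin m → ℝ) :
    objective p τ x y T (fun k => b k + θ (.inl k) / √(T : ℝ))
        (fun j => β j + θ (.inr j) / √(T : ℝ)) - objective p τ x y T b β =
      remSum p τ x b T e θ - score p τ x b T e ⬝ᵥ θ := by
  rw [score_dotProduct, objective, objective, remSum, ← Finset.sum_sub_distrib,
    ← Finset.sum_sub_distrib]
  refine Finset.sum_congr rfl fun k _ => ?_
  rw [← Finset.sum_sub_distrib, ← Finset.sum_sub_distrib]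
  refine Finset.sum_congr rfl fun t _ => ?_
  have h1 : x t ⬝ᵥ (fun j => β j + θ (.inr j) / √(T : ℝ)) =
      x t ⬝ᵥ β + x t ⬝ᵥ (θ ∘ Sum.inr) / √(T : ℝ) := by
    simp only [dotProduct, Finset.sum_div, ← Finset.sum_add_distrib, Function.comp]
    exact Finset.sum_congr rfl fun j _ => by ring
  rw [h1, hy, rem, shift]
  have h2 : x t ⬝ᵥ β + e t - (b k + θ (.inl k) / √(T : ℝ)) -
      (x t ⬝ᵥ β + x t ⬝ᵥ (θ ∘ Sum.inr) / √(T : ℝ)) =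
      e t - b k - (θ (.inl k) + x t ⬝ᵥ (θ ∘ Sum.inr)) / √(T : ℝ) := by ring
  have h3 : x t ⬝ᵥ β + e t - b k - x t ⬝ᵥ β = e t - b k := by ring
  rw [h2, h3]
  ring

lemma shift_add_smul (x : ℕ → Fin m → ℝ) (k : Fin K) (θ θ' : Fin K ⊕ Fin m → ℝ) (c d : ℝ)
    (t : ℕ) : shift x k (c • θ + d • θ') t = c * shift x k θ t + d * shift x k θ' t := by
  have : (c • θ + d • θ') ∘ Sum.inr = c • (θ ∘ Sum.inr) + d • (θ' ∘ (Sum.inr : Fin m → _)) := rfl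
  rw [shift, this, dotProduct_add, dotProduct_smul, dotProduct_smul, shift, shift]
  simp only [Pi.add_apply, Pi.smul_apply, smul_eq_mul]
  ring

lemma remSum_nonneg {p : ℝ} (hp : 1 < p) {τ : Fin K → ℝ} (hτ0 : ∀ k, 0 < τ k) (hτ1 : ∀ k, τ k < 1)
    (x : ℕ → Fin m → ℝ) (b : Fin K → ℝ) (T : ℕ) (e : ℕ → ℝ) (θ : Fin K ⊕ Fin m → ℝ) :
    0 ≤ remSum p τ x b T e θ :=
  Finset.sum_nonneg fun k _ => Finset.sum_nonneg fun _ _ =>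
    rem_nonneg hp (hτ0 k).le (hτ1 k).le _ _

lemma convexOn_remSum {p : ℝ} (hp : 1 < p) {τ : Fin K → ℝ} (hτ0 : ∀ k, 0 < τ k)
    (hτ1 : ∀ k, τ k < 1) (x : ℕ → Fin m → ℝ) (b : Fin K → ℝ) (T : ℕ) (e : ℕ → ℝ) :
    ConvexOn ℝ Set.univ (remSum p τ x b T e) := by
  refine ⟨convex_univ, fun θ _ θ' _ c d hc hd hcd => ?_⟩
  simp only [remSum, smul_eq_mul, Finset.mul_sum, ← Finset.sum_add_distrib]
  refine Finset.sum_le_sum fun k _ => Finset.sum_le_sum fun t _ => ?_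
  have := (convexOn_rem hp (hτ0 k).le (hτ1 k).le (e t - b k)).2
    (Set.mem_univ (shift x k θ t / √(T : ℝ))) (Set.mem_univ (shift x k θ' t / √(T : ℝ))) hc hd hcd
  rw [shift_add_smul]
  simp only [smul_eq_mul] at this
  convert! this using 2
  ring

/-! ### The limiting quadratic form -/

lemma continuous_limitQuad (a : Fin K → ℝ) (C : Matrix (Fin m) (Fin m) ℝ) :
    Continuous (limitQuad a C) := by
  unfold limitQuad Matrix.mulVec dotProduct
  simp only [Function.comp]
  fun_prop

lemma limitQuad_smul (a : Fin K → ℝ) (C : Matrix (Fin m) (Fin m) ℝ) (c : ℝ)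
    (θ : Fin K ⊕ Fin m → ℝ) : limitQuad a C (c • θ) = c ^ 2 * limitQuad a C θ := by
  have : (c • θ) ∘ Sum.inr = c • (θ ∘ (Sum.inr : Fin m → _)) := rfl
  rw [limitQuad, limitQuad, this, Finset.mul_sum, mulVec_smul, dotProduct_smul, smul_dotProduct]
  refine Finset.sum_congr rfl fun k _ => ?_
  simp only [Pi.smul_apply, smul_eq_mul]
  ring

lemma limitQuad_pos (hK : 0 < K) {a : Fin K → ℝ} (ha : ∀ k, 0 < a k)
    {C : Matrix (Fin m) (Fin m) ℝ} (hC : C.PosDef) {θ : Fin K ⊕ Fin m → ℝ} (hθ : θ ≠ 0) :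
    0 < limitQuad a C θ := by
  have hv0 : 0 ≤ (θ ∘ Sum.inr) ⬝ᵥ C *ᵥ (θ ∘ Sum.inr) := by
    simpa using hC.posSemidef.dotProduct_mulVec_nonneg (θ ∘ Sum.inr)
  by_cases hv : θ ∘ Sum.inr = (0 : Fin m → ℝ)
  · obtain ⟨k, hk⟩ : ∃ k, θ (.inl k) ≠ 0 := by
      by_contra! h
      exact hθ (funext fun i => by
        rcases i with i | i
        · exact h i
        · exact congrFun hv i)
    refine Finset.sum_pos' (fun k _ => ?_) ⟨k, Finset.mem_univ _, ?_⟩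
    · have := ha k; positivity
    · have := ha k; positivity
  · have hv1 : 0 < (θ ∘ Sum.inr) ⬝ᵥ C *ᵥ (θ ∘ Sum.inr) := by
      simpa using hC.dotProduct_mulVec_pos hv
    have : Nonempty (Fin K) := ⟨⟨0, hK⟩⟩
    refine Finset.sum_pos (fun k _ => ?_) Finset.univ_nonempty
    have := ha k; positivity

lemma exists_mul_norm_sq_le_limitQuad (hK : 0 < K) {a : Fin K → ℝ} (ha : ∀ k, 0 < a k)
    {C : Matrix (Fin m) (Fin m) ℝ} (hC : C.PosDef) :
    ∃ c : ℝ, 0 < c ∧ ∀ θ, c * ‖θ‖ ^ 2 ≤ limitQuad a C θ := by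
  have : Nonempty (Fin K) := ⟨⟨0, hK⟩⟩
  have hne : (Metric.sphere (0 : Fin K ⊕ Fin m → ℝ) 1).Nonempty :=
    NormedSpace.sphere_nonempty.2 zero_le_one
  obtain ⟨θ₀, hθ₀, hmin⟩ := (isCompact_sphere (0 : Fin K ⊕ Fin m → ℝ) 1).exists_isMinOn hne
    (continuous_limitQuad a C).continuousOn
  have h0 : θ₀ ≠ 0 := fun h => by simp [h] at hθ₀
  refine ⟨limitQuad a C θ₀, limitQuad_pos hK ha hC h0, fun θ => ?_⟩
  rcases eq_or_ne θ 0 with rfl | hθ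
  · simp [limitQuad]
  have hn : 0 < ‖θ‖ := norm_pos_iff.2 hθ
  have h1 : limitQuad a C θ₀ ≤ limitQuad a C (‖θ‖⁻¹ • θ) := hmin (by
    rw [mem_sphere_zero_iff_norm, norm_smul, norm_inv, norm_norm, inv_mul_cancel₀ hn.ne'])
  rw [limitQuad_smul] at h1
  calc limitQuad a C θ₀ * ‖θ‖ ^ 2 ≤ (‖θ‖⁻¹ ^ 2 * limitQuad a C θ) * ‖θ‖ ^ 2 := by gcongr
    _ = limitQuad a C θ := by field_simp

/-- Polarisation of the limiting quadratic form. -/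
lemma limitQuad_add {C : Matrix (Fin m) (Fin m) ℝ} (hC : C.IsHermitian) (a : Fin K → ℝ)
    (θ d : Fin K ⊕ Fin m → ℝ) :
    limitQuad a C (θ + d) = limitQuad a C θ + (∑ k, a k * θ (.inl k) * d (.inl k) +
      (∑ k, a k) * ((C *ᵥ (θ ∘ Sum.inr)) ⬝ᵥ (d ∘ Sum.inr))) + limitQuad a C d := by
  have h1 : (θ + d) ∘ Sum.inr = θ ∘ (Sum.inr : Fin m → _) + d ∘ Sum.inr := rfl
  have hCT : Cᵀ = C := by simpa using hC.eq
  have h2 : (θ ∘ Sum.inr) ⬝ᵥ C *ᵥ (d ∘ Sum.inr) = (C *ᵥ (θ ∘ Sum.inr)) ⬝ᵥ (d ∘ Sum.inr) := by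
    rw [dotProduct_mulVec, ← mulVec_transpose, hCT]
  have h3 : (d ∘ Sum.inr) ⬝ᵥ C *ᵥ (θ ∘ Sum.inr) = (C *ᵥ (θ ∘ Sum.inr)) ⬝ᵥ (d ∘ Sum.inr) :=
    dotProduct_comm _ _
  simp only [limitQuad, h1, mulVec_add, dotProduct_add, add_dotProduct, h2, h3, Finset.sum_mul,
    ← Finset.sum_add_distrib, Pi.add_apply]
  exact Finset.sum_congr rfl fun k _ => by ring

/-! ### Limits of the design -/

lemma tendsto_quad_design {x : ℕ → Fin m → ℝ} {C : Matrix (Fin m) (Fin m) ℝ}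
    (hdesign : Tendsto (fun T : ℕ => (T : ℝ)⁻¹ • ((designMatrix x T)ᵀ * designMatrix x T))
      atTop (𝓝 C)) (v : Fin m → ℝ) :
    Tendsto (fun T : ℕ => (T : ℝ)⁻¹ * ∑ t ∈ Finset.range T, (x t ⬝ᵥ v) ^ 2) atTop
      (𝓝 (v ⬝ᵥ C *ᵥ v)) := by
  have hc : Continuous fun M : Matrix (Fin m) (Fin m) ℝ => v ⬝ᵥ M *ᵥ v := by fun_prop
  refine ((hc.tendsto C).comp hdesign).congr fun T => ?_
  simp only [Function.comp]
  rw [smul_mulVec, dotProduct_smul, smul_eq_mul, ← mulVec_mulVec, dotProduct_mulVec,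
    vecMul_transpose, ← Fin.sum_univ_eq_sum_range (fun t => (x t ⬝ᵥ v) ^ 2)]
  congr 1
  refine Finset.sum_congr rfl fun t _ => ?_
  rw [sq]
  rfl

lemma tendsto_mean_design {x : ℕ → Fin m → ℝ}
    (hcenter : Tendsto (fun T : ℕ => (T : ℝ)⁻¹ • ∑ t ∈ Finset.range T, x t) atTop (𝓝 0))
    (v : Fin m → ℝ) :
    Tendsto (fun T : ℕ => (T : ℝ)⁻¹ * ∑ t ∈ Finset.range T, x t ⬝ᵥ v) atTop (𝓝 0) := by
  have hc : Continuous fun w : Fin m → ℝ => w ⬝ᵥ v := by fun_prop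
  have h := (hc.tendsto 0).comp hcenter
  rw [zero_dotProduct] at h
  refine h.congr fun T => ?_
  simp only [Function.comp]
  rw [smul_dotProduct, sum_dotProduct, smul_eq_mul]

/-- Centring of the design removes the cross term between intercepts and slopes. -/
lemma tendsto_shift_sq {x : ℕ → Fin m → ℝ} {C : Matrix (Fin m) (Fin m) ℝ}
    (hcenter : Tendsto (fun T : ℕ => (T : ℝ)⁻¹ • ∑ t ∈ Finset.range T, x t) atTop (𝓝 0))
    (hdesign : Tendsto (fun T : ℕ => (T : ℝ)⁻¹ • ((designMatrix x T)ᵀ * designMatrix x T))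
      atTop (𝓝 C)) (k : Fin K) (θ : Fin K ⊕ Fin m → ℝ) :
    Tendsto (fun T : ℕ => (T : ℝ)⁻¹ * ∑ t ∈ Finset.range T, shift x k θ t ^ 2) atTop
      (𝓝 (θ (.inl k) ^ 2 + (θ ∘ Sum.inr) ⬝ᵥ C *ᵥ (θ ∘ Sum.inr))) := by
  have h1 := tendsto_quad_design hdesign (θ ∘ Sum.inr)
  have h2 := (tendsto_mean_design hcenter (θ ∘ Sum.inr)).const_mul (2 * θ (.inl k))
  have h3 := (h1.add h2).const_add (θ (.inl k) ^ 2)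
  rw [mul_zero, add_zero] at h3
  refine h3.congr' ?_
  filter_upwards [eventually_gt_atTop 0] with T hT
  have hT' : (T : ℝ) ≠ 0 := by positivity
  simp only [shift, add_sq, Finset.sum_add_distrib, Finset.sum_const, Finset.card_range,
    nsmul_eq_mul, ← Finset.mul_sum]
  field_simp
  ring

end Local

/-! ### Stochastic behaviour of the two parts of the criterion -/

section Stochastic

variable {Ω : Type*} [MeasurableSpace Ω] {P : Measure Ω} [IsProbabilityMeasure P] {ν : Measure ℝ}
  {ε : ℕ → Ω → ℝ} {m K : ℕ} {p : ℝ} {τ b : Fin K → ℝ} {x : ℕ → Fin m → ℝ}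
  {C : Matrix (Fin m) (Fin m) ℝ}

/-- The second-order part of the criterion converges in probability to its quadratic limit,
uniformly on bounded sets. -/
lemma tendsto_measure_remSum (hlaw : ∀ t, HasLaw (ε t) ν P) (hindep : iIndepFun ε P)
    (hK : 0 < K) (hp : 1 < p) (hp2 : p ≤ 2) (hτ0 : ∀ k, 0 < τ k) (hτ1 : ∀ k, τ k < 1)
    (hint : ∀ k, Integrable (fun s => |s - b k| ^ (p - 2)) ν)
    (hne : ∀ k, ∀ᵐ s ∂ν, s ≠ b k ∨ (p = 2 ∧ τ k = 1 / 2))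
    (hcenter : Tendsto (fun T : ℕ => (T : ℝ)⁻¹ • ∑ t ∈ Finset.range T, x t) atTop (𝓝 0))
    (hdesign : Tendsto (fun T : ℕ => (T : ℝ)⁻¹ • ((designMatrix x T)ᵀ * designMatrix x T))
      atTop (𝓝 C)) {R ρ : ℝ} (hR : 0 ≤ R) (hρ : 0 < ρ) :
    Tendsto (fun T : ℕ => P {ω | ∃ θ, ‖θ‖ ≤ R ∧ ρ < |remSum p τ x b T (fun t => ε t ω) θ -
      limitQuad (fun k => ∫ s, psi p (τ k) (s - b k) ∂ν) C θ|}) atTop (𝓝 0) := by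
  set a : Fin K → ℝ := fun k => ∫ s, psi p (τ k) (s - b k) ∂ν with ha
  obtain ⟨F, δ, hδ, hF⟩ := exists_finset_forall_convexOn (continuous_limitQuad a C) hR hρ
  have hK' : (0 : ℝ) < K := by exact_mod_cast hK
  set X : ℕ → (Fin K ⊕ Fin m → ℝ) → Fin K → Set Ω := fun T θ k =>
    {ω | δ / K ≤ |∑ t ∈ Finset.range T, rem p (τ k) (ε t ω - b k) (shift x k θ t / √(T : ℝ)) -
      a k / 2 * (θ (.inl k) ^ 2 + (θ ∘ Sum.inr) ⬝ᵥ C *ᵥ (θ ∘ Sum.inr))|} with hX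
  have hXt : ∀ θ k, Tendsto (fun T => P (X T θ k)) atTop (𝓝 0) := fun θ k =>
    tendsto_measure_sum_rem hlaw hindep hp hp2 (hτ0 k).le (hτ1 k).le (hint k) (hne k)
      (tendsto_shift_sq hcenter hdesign k θ) (by positivity)
  have hsum : Tendsto (fun T => ∑ θ ∈ F, ∑ k, P (X T θ k)) atTop (𝓝 0) := by
    have := tendsto_finsetSum F fun θ _ => tendsto_finsetSum Finset.univ fun k _ => hXt θ k
    simpa using this
  refine tendsto_of_tendsto_of_tendsto_of_le_of_le tendsto_const_nhds hsum
    (fun _ => zero_le) fun T => ?_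
  calc _ ≤ P (⋃ θ ∈ F, ⋃ k ∈ Finset.univ, X T θ k) := measure_mono fun ω hω => ?_
    _ ≤ ∑ θ ∈ F, ∑ k, P (X T θ k) :=
      (measure_biUnion_finset_le _ _).trans
        (Finset.sum_le_sum fun θ _ => measure_biUnion_finset_le _ _)
  obtain ⟨θ, hθ, hlt⟩ := hω
  by_contra hnot
  refine hlt.not_ge (hF _ (convexOn_remSum hp hτ0 hτ1 x b T _) (remSum_nonneg hp hτ0 hτ1 x b T _)
    (fun θ' hθ' => ?_) θ hθ)
  rw [remSum, limitQuad, ← Finset.sum_sub_distrib]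
  refine (Finset.abs_sum_le_sum_abs _ _).trans ?_
  calc _ ≤ ∑ _k : Fin K, δ / K := Finset.sum_le_sum fun k _ => ?_
    _ = δ := by
      rw [Finset.sum_const, Finset.card_univ, Fintype.card_fin, nsmul_eq_mul]; field_simp
  by_contra! hgt
  exact hnot (Set.mem_biUnion hθ' (Set.mem_biUnion (Finset.mem_univ k) hgt.le))

lemma measurable_totalPhi (hp : 1 < p) (hτ0 : ∀ k, 0 < τ k) (hτ1 : ∀ k, τ k < 1) :
    Measurable (totalPhi p τ b) := by
  unfold totalPhi
  exact Finset.measurable_sum _ fun k _ =>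
    (measurable_phi hp (hτ0 k).le (hτ1 k).le).comp (measurable_id.sub_const (b k))

lemma memLp_totalPhi [IsFiniteMeasure ν] (hp : 1 < p) (hp2 : p ≤ 2) (hτ0 : ∀ k, 0 < τ k)
    (hτ1 : ∀ k, τ k < 1) (hmoment : Integrable (fun s : ℝ => |s| ^ (2 * (p - 1))) ν) :
    MemLp (totalPhi p τ b) 2 ν := by
  unfold totalPhi
  exact memLp_finsetSum _ fun k _ => memLp_phi hp hp2 (hτ0 k).le (hτ1 k).le hmoment (b k)

lemma integral_totalPhi_eq_zero [IsProbabilityMeasure ν] (hp : 1 < p) (hp2 : p ≤ 2)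
    (hτ0 : ∀ k, 0 < τ k) (hτ1 : ∀ k, τ k < 1)
    (hmoment : Integrable (fun s : ℝ => |s| ^ (2 * (p - 1))) ν)
    (h0 : ∀ k, ∫ s, phi p (τ k) (s - b k) ∂ν = 0) : ∫ s, totalPhi p τ b s ∂ν = 0 := by
  unfold totalPhi
  rw [integral_finsetSum _ fun k _ =>
    (memLp_phi hp hp2 (hτ0 k).le (hτ1 k).le hmoment (b k)).integrable one_le_two]
  exact Finset.sum_eq_zero fun k _ => h0 k

lemma integral_totalPhi_sq [IsFiniteMeasure ν] (hp : 1 < p) (hp2 : p ≤ 2)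
    (hτ0 : ∀ k, 0 < τ k) (hτ1 : ∀ k, τ k < 1)
    (hmoment : Integrable (fun s : ℝ => |s| ^ (2 * (p - 1))) ν) :
    ∫ s, totalPhi p τ b s ^ 2 ∂ν =
      ∑ k', ∑ k, ∫ s, phi p (τ k') (s - b k') * phi p (τ k) (s - b k) ∂ν := by
  have hi : ∀ k' k, Integrable (fun s => phi p (τ k') (s - b k') * phi p (τ k) (s - b k)) ν :=
    fun k' k => (memLp_phi hp hp2 (hτ0 k').le (hτ1 k').le hmoment (b k')).integrable_mul
      (memLp_phi hp hp2 (hτ0 k).le (hτ1 k).le hmoment (b k))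
  simp only [totalPhi, sq, Finset.sum_mul_sum]
  rw [integral_finsetSum _ fun k' _ => integrable_finsetSum _ fun k _ => hi k' k]
  exact Finset.sum_congr rfl fun k' _ => integral_finsetSum _ fun k _ => hi k' k

/-- The score is bounded in probability. -/
lemma exists_eventually_measure_score_le (hlaw : ∀ t, HasLaw (ε t) ν P) (hindep : iIndepFun ε P)
    (hp : 1 < p) (hp2 : p ≤ 2) (hτ0 : ∀ k, 0 < τ k) (hτ1 : ∀ k, τ k < 1)
    (hmoment : Integrable (fun s : ℝ => |s| ^ (2 * (p - 1))) ν)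
    (h0 : ∀ k, ∫ s, phi p (τ k) (s - b k) ∂ν = 0)
    (hdesign : Tendsto (fun T : ℕ => (T : ℝ)⁻¹ • ((designMatrix x T)ᵀ * designMatrix x T))
      atTop (𝓝 C)) {η : ℝ} (hη : 0 < η) :
    ∃ M : ℝ, 0 < M ∧ ∀ᶠ T : ℕ in atTop,
      P {ω | M < ‖score p τ x b T (fun t => ε t ω)‖} ≤ ENNReal.ofReal η := by
  have : IsProbabilityMeasure ν := (hlaw 0).isProbabilityMeasure_iff.1 inferInstance
  set n : ℕ := Fintype.card (Fin K ⊕ Fin m) with hn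
  set η' : ℝ := η / (n + 1) with hη'
  have hη'0 : 0 < η' := by positivity
  have hcoord : ∀ i, ∃ M : ℝ, ∀ᶠ T : ℕ in atTop,
      P {ω | M ≤ |score p τ x b T (fun t => ε t ω) i|} ≤ ENNReal.ofReal η' := by
    rintro (k | j)
    · have hz : Tendsto (fun T : ℕ => (T : ℝ)⁻¹ * ∑ t ∈ Finset.range T, (1 : ℝ) ^ 2) atTop
          (𝓝 1) := by
        refine tendsto_const_nhds.congr' ?_
        filter_upwards [eventually_gt_atTop 0] with T hT
        have hT' : (T : ℝ) ≠ 0 := by positivity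
        simp [hT']
      exact exists_eventually_measure_abs_sum_le hlaw hindep
        ((measurable_phi hp (hτ0 k).le (hτ1 k).le).comp (measurable_id.sub_const (b k)))
        (memLp_phi hp hp2 (hτ0 k).le (hτ1 k).le hmoment (b k)) (h0 k) hz hη'0
    · have hz := tendsto_quad_design hdesign (Pi.single j 1)
      simp only [dotProduct_single, mul_one] at hz
      exact exists_eventually_measure_abs_sum_le hlaw hindep (measurable_totalPhi hp hτ0 hτ1)
        (memLp_totalPhi hp hp2 hτ0 hτ1 hmoment)
        (integral_totalPhi_eq_zero hp hp2 hτ0 hτ1 hmoment h0) hz hη'0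
  choose M hM using hcoord
  refine ⟨∑ i, |M i| + 1, by positivity, ?_⟩
  filter_upwards [eventually_all.2 hM] with T hT
  calc _ ≤ P (⋃ i ∈ Finset.univ, {ω | M i ≤ |score p τ x b T (fun t => ε t ω) i|}) :=
        measure_mono fun ω hω => ?_
    _ ≤ ∑ i, P {ω | M i ≤ |score p τ x b T (fun t => ε t ω) i|} := measure_biUnion_finset_le _ _
    _ ≤ ∑ _i : Fin K ⊕ Fin m, ENNReal.ofReal η' := Finset.sum_le_sum fun i _ => hT i
    _ = ENNReal.ofReal (n * η') := by
        rw [Finset.sum_const, Finset.card_univ, ← hn, nsmul_eq_mul,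
          ENNReal.ofReal_mul (Nat.cast_nonneg n), ENNReal.ofReal_natCast]
    _ ≤ ENNReal.ofReal η := by
        refine ENNReal.ofReal_le_ofReal ?_
        rw [hη', mul_div_assoc', div_le_iff₀ (by positivity)]
        nlinarith
  by_contra hnot
  simp only [Set.mem_iUnion, not_exists] at hnot
  refine (show ∑ i, |M i| + 1 < ‖score p τ x b T (fun t => ε t ω)‖ from hω).not_ge ?_
  refine (pi_norm_le_iff_of_nonneg (by positivity)).2 fun i => ?_
  have h1 : |score p τ x b T (fun t => ε t ω) i| < M i := not_le.1 (hnot i (Finset.mem_univ i))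
  have h2 : |M i| ≤ ∑ i, |M i| :=
    Finset.single_le_sum (f := fun i => |M i|) (fun _ _ => abs_nonneg _) (Finset.mem_univ i)
  rw [Real.norm_eq_abs]
  linarith [le_abs_self (M i)]

end Stochastic

/-! ### The penalty in local coordinates -/

section Penalty

variable {m K : ℕ}

/-- The increment of the adaptive penalty in local coordinates, with `s = √T`. -/
noncomputable def penLocal (lam : ℝ) (w β : Fin m → ℝ) (s : ℝ) (θ : Fin K ⊕ Fin m → ℝ) : ℝ :=
  lam * (penalty w (fun j => β j + θ (.inr j) / s) - penalty w β)

open Classical in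
/-- The local parameter with the slopes outside the support of `β` set to zero. -/
noncomputable def restrictSupport (β : Fin m → ℝ) (θ : Fin K ⊕ Fin m → ℝ) : Fin K ⊕ Fin m → ℝ :=
  Sum.elim (fun k => θ (.inl k)) fun j => if β j = 0 then 0 else θ (.inr j)

lemma penLocal_zero (lam : ℝ) (w β : Fin m → ℝ) (s : ℝ) :
    penLocal lam w β s (0 : Fin K ⊕ Fin m → ℝ) = 0 := by
  simp [penLocal]

lemma convexOn_penLocal {lam : ℝ} (hlam : 0 ≤ lam) (w β : Fin m → ℝ) (s : ℝ) :
    ConvexOn ℝ Set.univ (penLocal (K := K) lam w β s) := by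
  refine ⟨convex_univ, fun θ _ θ' _ c d hc hd hcd => ?_⟩
  have h1 : ∀ j, |β j + (c • θ + d • θ') (.inr j) / s| / |w j| ^ 2 ≤
      c * (|β j + θ (.inr j) / s| / |w j| ^ 2) + d * (|β j + θ' (.inr j) / s| / |w j| ^ 2) := by
    intro j
    rw [mul_div_assoc', mul_div_assoc', ← add_div]
    gcongr
    have e : β j + (c • θ + d • θ') (.inr j) / s =
        c * (β j + θ (.inr j) / s) + d * (β j + θ' (.inr j) / s) := by
      simp only [Pi.add_apply, Pi.smul_apply, smul_eq_mul]
      linear_combination -β j * hcd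
    rw [e]
    refine (abs_add_le _ _).trans_eq ?_
    rw [abs_mul, abs_mul, abs_of_nonneg hc, abs_of_nonneg hd]
  have h2 := Finset.sum_le_sum fun j (_ : j ∈ Finset.univ) => h1 j
  rw [Finset.sum_add_distrib, ← Finset.mul_sum, ← Finset.mul_sum] at h2
  have h3 := mul_le_mul_of_nonneg_left h2 hlam
  simp only [penLocal, smul_eq_mul, penalty]
  have h4 : lam * ∑ j, |β j| / |w j| ^ 2 =
    (c + d) * (lam * ∑ j, |β j| / |w j| ^ 2) := by rw [hcd, one_mul]
  linear_combination h3 - h4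

lemma penLocal_eq_add {s : ℝ} (hs : 0 < s) (lam : ℝ) (w β : Fin m → ℝ)
    (θ : Fin K ⊕ Fin m → ℝ) :
    penLocal lam w β s θ = penLocal lam w β s (restrictSupport β θ) +
      lam * ∑ j, |θ (.inr j) - restrictSupport β θ (.inr j)| / s / |w j| ^ 2 := by
  rw [penLocal, penLocal, ← mul_add]
  congr 1
  rw [sub_add_eq_add_sub]
  congr 1
  rw [penalty, penalty, ← Finset.sum_add_distrib]
  refine Finset.sum_congr rfl fun j _ => ?_
  rw [← add_div]
  congr 1
  by_cases h : β j = 0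
  · simp [restrictSupport, h, abs_div, abs_of_pos hs]
  · simp [restrictSupport, h]

lemma abs_penLocal_restrictSupport_le {s lam d : ℝ} (hs : 0 < s) (hlam : 0 ≤ lam) (hd : 0 < d)
    {w β : Fin m → ℝ} (hw : ∀ j, β j ≠ 0 → d ≤ |w j|) (θ : Fin K ⊕ Fin m → ℝ) :
    |penLocal lam w β s (restrictSupport β θ)| ≤ lam / s * (m / d ^ 2) * ‖θ‖ := by
  rw [penLocal, abs_mul, abs_of_nonneg hlam, penalty, penalty, ← Finset.sum_sub_distrib]
  have h1 : ∀ j, |(|β j + restrictSupport β θ (.inr j) / s| / |w j| ^ 2 - |β j| / |w j| ^ 2)| ≤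
      ‖θ‖ / s / d ^ 2 := by
    intro j
    by_cases h : β j = 0
    · simp only [restrictSupport, h, Sum.elim_inr, if_true, zero_div, add_zero, sub_self, abs_zero]
      positivity
    · simp only [restrictSupport, h, Sum.elim_inr, if_false]
      have hwj := hw j h
      rw [← sub_div, abs_div, abs_of_nonneg (by positivity : 0 ≤ |w j| ^ 2)]
      have h2 : |(|β j + θ (.inr j) / s| - |β j|)| ≤ ‖θ‖ / s := by
        refine (abs_abs_sub_abs_le_abs_sub _ _).trans ?_
        rw [add_sub_cancel_left, abs_div, abs_of_pos hs]
        gcongr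
        exact norm_le_pi_norm θ (.inr j)
      gcongr
  calc _ ≤ lam * ∑ _j : Fin m, ‖θ‖ / s / d ^ 2 := by
        gcongr
        exact (Finset.abs_sum_le_sum_abs _ _).trans (Finset.sum_le_sum fun j _ => h1 j)
    _ = lam / s * (m / d ^ 2) * ‖θ‖ := by
        rw [Finset.sum_const, Finset.card_univ, Fintype.card_fin, nsmul_eq_mul]; ring

lemma restrictSupport_eq_self {β : Fin m → ℝ} {θ : Fin K ⊕ Fin m → ℝ}
    (h : ∀ j, β j = 0 → θ (.inr j) = 0) : restrictSupport β θ = θ := by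
  ext i
  rcases i with k | j
  · rfl
  · by_cases hj : β j = 0
    · simp [restrictSupport, hj, h j hj]
    · simp [restrictSupport, hj]

lemma norm_restrictSupport_le (β : Fin m → ℝ) (θ : Fin K ⊕ Fin m → ℝ) :
    ‖restrictSupport β θ‖ ≤ ‖θ‖ := by
  refine (pi_norm_le_iff_of_nonneg (norm_nonneg _)).2 fun i => ?_
  rcases i with k | j
  · exact norm_le_pi_norm θ (.inl k)
  · by_cases hj : β j = 0
    · simp [restrictSupport, hj]
    · simpa [restrictSupport, hj] using norm_le_pi_norm θ (.inr j)

end Penalty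

/-! ### Minimisers of perturbed quadratic criteria -/

section Deterministic

lemma abs_dotProduct_le_sum {ι : Type*} [Fintype ι] (z θ : ι → ℝ) :
    |z ⬝ᵥ θ| ≤ ‖z‖ * ∑ i, |θ i| := by
  rw [dotProduct, Finset.mul_sum]
  refine (Finset.abs_sum_le_sum_abs _ _).trans (Finset.sum_le_sum fun i _ => ?_)
  rw [abs_mul]
  gcongr
  exact norm_le_pi_norm z i

lemma abs_dotProduct_le {ι : Type*} [Fintype ι] (z θ : ι → ℝ) :
    |z ⬝ᵥ θ| ≤ Fintype.card ι * ‖z‖ * ‖θ‖ := by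
  refine (abs_dotProduct_le_sum z θ).trans ?_
  have : ∑ i, |θ i| ≤ ∑ _i : ι, ‖θ‖ := Finset.sum_le_sum fun i _ => norm_le_pi_norm θ i
  rw [Finset.sum_const, Finset.card_univ, nsmul_eq_mul] at this
  calc ‖z‖ * ∑ i, |θ i| ≤ ‖z‖ * (Fintype.card ι * ‖θ‖) := by gcongr
    _ = _ := by ring

/-- A radius beyond which the quadratic growth `c r ^ 2` beats a linear term. -/
lemma exists_radius {c : ℝ} (hc : 0 < c) {L : ℝ} (hL : 0 ≤ L) :
    ∃ r : ℝ, 0 < r ∧ (L + 1) * r + 1 < c * r ^ 2 := by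
  refine ⟨(L + 2) / c + 1, by positivity, ?_⟩
  set r := (L + 2) / c + 1 with hr
  have h1 : c * r = L + 2 + c := by rw [hr]; field_simp
  have h2 : 1 ≤ r := by
    have : 0 ≤ (L + 2) / c := by positivity
    linarith
  nlinarith

variable {ι : Type*} [Fintype ι] {Q q pen : (ι → ℝ) → ℝ} {z : ι → ℝ} {c M r : ℝ}

/-- Localisation of minimisers: if the convex criterion `Q - z + pen` is close to a quadratic
criterion on a large ball and `pen` is at worst linear, then every point at which the criterion is
nonpositive lies in that ball. -/
lemma norm_le_of_criterion_le (hQ : ConvexOn ℝ Set.univ Q) (hQ0 : Q 0 = 0)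
    (hq : ∀ θ, c * ‖θ‖ ^ 2 ≤ q θ) (hz : ‖z‖ ≤ M) (hr : 0 < r)
    (hrM : (Fintype.card ι * M + 1) * r + 1 < c * r ^ 2) (hQq : ∀ θ, ‖θ‖ ≤ r → |Q θ - q θ| ≤ 1)
    (hpen : ConvexOn ℝ Set.univ pen) (hpen0 : pen 0 = 0) (hpenle : ∀ θ, -‖θ‖ ≤ pen θ)
    {θ : ι → ℝ} (hθ : Q θ - z ⬝ᵥ θ + pen θ ≤ 0) : ‖θ‖ ≤ r := by
  have hlin : ConvexOn ℝ Set.univ fun θ : ι → ℝ => -(z ⬝ᵥ θ) := by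
    refine ⟨convex_univ, fun a _ b _ s t _ _ _ => le_of_eq ?_⟩
    simp only [dotProduct_add, dotProduct_smul, smul_eq_mul]
    ring
  have hF : ConvexOn ℝ Set.univ fun θ => Q θ - z ⬝ᵥ θ + pen θ :=
    ((hQ.add hlin).add hpen).congr fun θ _ => by simp [sub_eq_add_neg]
  refine norm_le_of_convexOn hF (Set.mem_univ _) (by simp [hQ0, hpen0]) hr
    (fun θ' _ hθ' => ?_) (Set.mem_univ θ) hθ
  have h1 := (abs_le.1 (hQq θ' hθ'.le)).1
  have h2 := hq θ'
  have h3 := (abs_le.1 (abs_dotProduct_le z θ')).2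
  have h4 := hpenle θ'
  rw [hθ'] at h2 h3 h4
  have h5 : Fintype.card ι * ‖z‖ * r ≤ Fintype.card ι * M * r := by gcongr
  linarith

end Deterministic

section Adaptive

variable {m K : ℕ} {Q q : (Fin K ⊕ Fin m → ℝ) → ℝ} {z : Fin K ⊕ Fin m → ℝ} {c M r : ℝ}

/-- Behaviour of a minimiser of the penalised criterion `Q - z + pen` when `Q` is close to the
quadratic form `q`: it has exactly the right support, and it is close to the minimiser `θ₀` of
`q - z` among the parameters with that support. The constants: `M` bounds the linear part, `B` the
quadratic part, `r₁` the pilot error, `2 d` bounds the nonzero coefficients from below, `ρ` measures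
the distance of `Q` to `q` and the size of the penalty on the support. -/
lemma adaptive_minimizer (hQ : ConvexOn ℝ Set.univ Q) (hQnn : ∀ θ, 0 ≤ Q θ) (hQ0 : Q 0 = 0)
    (hc : 0 < c) (hq : ∀ θ, c * ‖θ‖ ^ 2 ≤ q θ) (hq0 : q 0 = 0) (hz : ‖z‖ ≤ M) (hr : 0 < r)
    (hrM : (Fintype.card (Fin K ⊕ Fin m) * M + 1) * r + 1 < c * r ^ 2)
    {ρ B : ℝ} (hρ1 : ρ ≤ 1) (hQq : ∀ θ, ‖θ‖ ≤ r + 2 → |Q θ - q θ| ≤ ρ)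
    (hB : ∀ θ, ‖θ‖ ≤ r + 2 → q θ + 1 ≤ B)
    {s lam d r₁ : ℝ} (hs : 0 < s) (hlam : 0 ≤ lam) (hd : 0 < d) (hr₁ : 0 < r₁)
    {w β : Fin m → ℝ} (hβ : ∀ j, β j ≠ 0 → 2 * d ≤ |β j|) (hwβ : ∀ j, s * |w j - β j| ≤ r₁)
    (hsd : r₁ ≤ d * s) (hsr : r < 2 * d * s) (hlarge : (2 * B + M) * r₁ ^ 2 < lam * s)
    (hsmall : lam / s * (m / d ^ 2) ≤ 1) (hsmallρ : lam / s * (m / d ^ 2) * r ≤ ρ)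
    {θ : Fin K ⊕ Fin m → ℝ} (hθw : ∀ j, w j = 0 → β j + θ (.inr j) / s = 0)
    (hmin : ∀ θ' : Fin K ⊕ Fin m → ℝ, (∀ j, w j = 0 → β j + θ' (.inr j) / s = 0) →
      Q θ - z ⬝ᵥ θ + penLocal lam w β s θ ≤ Q θ' - z ⬝ᵥ θ' + penLocal lam w β s θ')
    {θ₀ : Fin K ⊕ Fin m → ℝ} (hθ₀ : ∀ j, β j = 0 → θ₀ (.inr j) = 0)
    (hθ₀q : ∀ η : Fin K ⊕ Fin m → ℝ, (∀ j, β j = 0 → η (.inr j) = 0) →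
      q (θ₀ + η) - z ⬝ᵥ (θ₀ + η) = q θ₀ - z ⬝ᵥ θ₀ + q η) :
    (∀ j, β j + θ (.inr j) / s ≠ 0 ↔ β j ≠ 0) ∧ c * ‖θ - θ₀‖ ^ 2 ≤ 4 * ρ := by
  have hM0 : 0 ≤ M := (norm_nonneg z).trans hz
  have hwd : ∀ j, β j ≠ 0 → d ≤ |w j| := fun j hj => by
    have h1 := hβ j hj
    have h2 : |w j - β j| ≤ d := by
      have := (hwβ j).trans hsd
      rw [mul_comm] at this
      exact le_of_mul_le_mul_right this hs
    have h3 := abs_sub_abs_le_abs_sub (β j) (w j)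
    rw [abs_sub_comm] at h3
    linarith
  -- a coefficient in the support has a nonzero pilot estimate, so the constraint concerns only
  -- coefficients whose true value is zero
  have hw0 : ∀ j, w j = 0 → β j = 0 := fun j hj => by
    by_contra h
    have := hwd j h
    rw [hj, abs_zero] at this
    linarith
  have hfeas : ∀ θ' : Fin K ⊕ Fin m → ℝ, (∀ j, β j = 0 → θ' (.inr j) = 0) →
      ∀ j, w j = 0 → β j + θ' (.inr j) / s = 0 := fun θ' h j hj => by
    rw [hw0 j hj, h j (hw0 j hj)]; simp
  have hpenbd := abs_penLocal_restrictSupport_le (K := K) hs hlam hd hwd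
  have hextra : ∀ θ : Fin K ⊕ Fin m → ℝ,
      0 ≤ lam * ∑ j, |θ (.inr j) - restrictSupport β θ (.inr j)| / s / |w j| ^ 2 := fun θ =>
    mul_nonneg hlam (Finset.sum_nonneg fun _ _ => by positivity)
  have hθr : ‖θ‖ ≤ r := by
    refine norm_le_of_criterion_le hQ hQ0 hq hz hr hrM
      (fun θ' hθ' => (hQq θ' (by linarith)).trans hρ1) (convexOn_penLocal hlam w β s)
      (penLocal_zero lam w β s) (fun θ' => ?_) ?_
    · rw [penLocal_eq_add hs]
      have h1 := (abs_le.1 (hpenbd θ')).1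
      have h2 := hextra θ'
      have h3 : lam / s * (m / d ^ 2) * ‖θ'‖ ≤ ‖θ'‖ := mul_le_of_le_one_left (norm_nonneg _) hsmall
      linarith
    · have := hmin 0 (hfeas 0 fun _ _ => rfl)
      simpa [hQ0, penLocal_zero] using this
  -- removing the coefficients outside the support changes `Q - z` by at most a multiple of their
  -- absolute sum, which the adaptive penalty outweighs
  have hsupp : ∀ j, β j = 0 → θ (.inr j) = 0 := by
    set θ' := restrictSupport β θ with hθ'
    set D : ℝ := ∑ j, |θ (.inr j) - θ' (.inr j)| with hD
    have hθ'r : ‖θ'‖ ≤ r := (norm_restrictSupport_le β θ).trans hθr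
    have h1 := hmin θ' (hfeas θ' fun j hj => by simp [hθ', restrictSupport, hj])
    rw [penLocal_eq_add hs lam w β θ, ← hθ'] at h1
    have hDsum : ∑ i, |(θ - θ') i| = D := by
      rw [Fintype.sum_sum_type]
      simp [hθ', restrictSupport, hD]
    have hDnorm : ‖θ - θ'‖ ≤ D := by
      rw [← hDsum]
      refine (pi_norm_le_iff_of_nonneg (Finset.sum_nonneg fun _ _ => abs_nonneg _)).2 fun i => ?_
      exact Finset.single_le_sum (f := fun i => |(θ - θ') i|) (fun _ _ => abs_nonneg _)
        (Finset.mem_univ i)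
    have hQB : ∀ θ, ‖θ‖ ≤ r + 2 → Q θ ≤ B := fun θ hθ => by
      have := (abs_le.1 (hQq θ hθ)).2
      linarith [hB θ hθ]
    have hB0 : 0 ≤ B := (hQnn 0).trans (hQB 0 (by simp; linarith))
    have h2 : Q θ' - Q θ ≤ 2 * B * D := by
      have := abs_sub_le_of_convexOn hQ hQnn hQB hθ'r hθr
      rw [norm_sub_rev] at this
      exact (le_abs_self _).trans (this.trans (by gcongr))
    have h3 : z ⬝ᵥ θ - z ⬝ᵥ θ' ≤ M * D := by
      rw [← dotProduct_sub]
      refine (le_abs_self _).trans ((abs_dotProduct_le_sum z _).trans ?_)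
      rw [hDsum]
      have : 0 ≤ D := (norm_nonneg _).trans hDnorm
      gcongr
    have h4 : lam * s / r₁ ^ 2 * D ≤
        lam * ∑ j, |θ (.inr j) - θ' (.inr j)| / s / |w j| ^ 2 := by
      rw [hD, mul_div_assoc, mul_assoc, Finset.mul_sum]
      refine mul_le_mul_of_nonneg_left (Finset.sum_le_sum fun j _ => ?_) hlam
      by_cases hj : β j = 0
      · by_cases hwj : w j = 0
        · have h0 : θ (.inr j) = 0 := by
            have := hθw j hwj
            rw [hj, zero_add, div_eq_zero_iff] at this
            exact this.resolve_right hs.ne'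
          simp [hθ', restrictSupport, hj, h0]
        · have h5 := hwβ j
          rw [hj, sub_zero] at h5
          have hwpos : 0 < |w j| := abs_pos.2 hwj
          rw [div_div, div_mul_eq_mul_div, div_le_div_iff₀ (by positivity) (by positivity)]
          have h6 : (s * |w j|) ^ 2 ≤ r₁ ^ 2 := by gcongr
          calc s * |θ (.inr j) - θ' (.inr j)| * (s * |w j| ^ 2)
              = |θ (.inr j) - θ' (.inr j)| * (s * |w j|) ^ 2 := by ring
            _ ≤ |θ (.inr j) - θ' (.inr j)| * r₁ ^ 2 := by gcongr
      · simp [hθ', restrictSupport, hj]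
    have h7 : 2 * B + M < lam * s / r₁ ^ 2 := by
      rwa [lt_div_iff₀ (by positivity)]
    have hD0 : D ≤ 0 := by
      by_contra! hDpos
      nlinarith
    intro j hj
    have h8 : |θ (.inr j) - θ' (.inr j)| ≤ D :=
      Finset.single_le_sum (f := fun j => |θ (.inr j) - θ' (.inr j)|) (fun _ _ => abs_nonneg _)
        (Finset.mem_univ j)
    have h9 : θ' (.inr j) = 0 := by simp [hθ', restrictSupport, hj]
    rw [h9, sub_zero] at h8
    exact abs_eq_zero.1 (le_antisymm (h8.trans hD0) (abs_nonneg _))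
  refine ⟨fun j => ⟨fun h hj => h (by rw [hj, hsupp j hj]; simp), fun hj h => ?_⟩, ?_⟩
  · have h1 : β j * s = -θ (.inr j) := by field_simp at h; linarith
    have h2 : |β j| * s = |θ (.inr j)| := by
      have := congrArg abs h1
      rwa [abs_mul, abs_of_pos hs, abs_neg] at this
    have h3 : |θ (.inr j)| ≤ r := (norm_le_pi_norm θ (.inr j)).trans hθr
    have h4 := mul_le_mul_of_nonneg_right (hβ j hj) hs.le
    linarith
  · -- the quadratic minimiser is bounded: compare it with the origin
    have hθ₀r : ‖θ₀‖ ≤ r := by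
      have h1 := hθ₀q (-θ₀) fun j hj => by simp [hθ₀ j hj]
      rw [add_neg_cancel, hq0, dotProduct_zero] at h1
      have h2 := hq (-θ₀)
      rw [norm_neg] at h2
      have h3 := hq θ₀
      have h4 := (abs_le.1 (abs_dotProduct_le z θ₀)).2
      have h5 : Fintype.card (Fin K ⊕ Fin m) * ‖z‖ * ‖θ₀‖ ≤
          Fintype.card (Fin K ⊕ Fin m) * M * ‖θ₀‖ := by gcongr
      by_contra! hlt
      have h6 : 0 ≤ c * ‖θ₀‖ ^ 2 := by positivity
      have h7 : c * r * ‖θ₀‖ ≤ c * ‖θ₀‖ ^ 2 := by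
        rw [sq, ← mul_assoc]; gcongr
      have h8 : (Fintype.card (Fin K ⊕ Fin m) * M) < c * r := by
        by_contra! hle
        nlinarith
      have h9 : 0 < ‖θ₀‖ := hr.trans hlt
      nlinarith
    have h1 := hmin θ₀ (hfeas θ₀ hθ₀)
    have h2 := hθ₀q (θ - θ₀) fun j hj => by simp [hθ₀ j hj, hsupp j hj]
    rw [add_sub_cancel] at h2
    have h3 := hq (θ - θ₀)
    have h4 := hpenbd θ
    have h5 := hpenbd θ₀
    rw [restrictSupport_eq_self hsupp] at h4
    rw [restrictSupport_eq_self hθ₀] at h5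
    have hk : 0 ≤ lam / s * (m / d ^ 2) := by positivity
    have h6 : lam / s * (m / d ^ 2) * ‖θ‖ ≤ ρ := (by gcongr : _ ≤ _).trans hsmallρ
    have h7 : lam / s * (m / d ^ 2) * ‖θ₀‖ ≤ ρ := (by gcongr : _ ≤ _).trans hsmallρ
    have h8 := (abs_le.1 (hQq θ (by linarith))).1
    have h9 := (abs_le.1 (hQq θ₀ (by linarith))).2
    have h10 := (abs_le.1 h4).1
    have h11 := (abs_le.1 h5).2
    linarith

end Adaptive

/-! ### The minimiser of the limiting criterion on the true support -/

section Oracle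

variable {m K : ℕ}

/-- Extension by zero of a vector indexed by the support of `β`. -/
noncomputable def extendZero (β : Fin m → ℝ) (u : {j : Fin m // β j ≠ 0} → ℝ) (j : Fin m) : ℝ :=
  if h : β j ≠ 0 then u ⟨j, h⟩ else 0

lemma dotProduct_extendZero (β : Fin m → ℝ) (w : Fin m → ℝ) (u : {j : Fin m // β j ≠ 0} → ℝ) :
    w ⬝ᵥ extendZero β u = (fun i : {j : Fin m // β j ≠ 0} => w i) ⬝ᵥ u := by
  rw [dotProduct, ← Fintype.sum_subtype_add_sum_subtype (fun j => β j ≠ 0)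
    (fun j => w j * extendZero β u j), dotProduct]
  have h1 : ∑ i : {j : Fin m // ¬β j ≠ 0}, w i * extendZero β u i = 0 :=
    Finset.sum_eq_zero fun i _ => by rw [extendZero, dif_neg i.2, mul_zero]
  rw [h1, add_zero]
  exact Finset.sum_congr rfl fun i _ => by rw [extendZero, dif_pos i.2]

lemma mulVec_extendZero (C : Matrix (Fin m) (Fin m) ℝ) (β : Fin m → ℝ)
    (u : {j : Fin m // β j ≠ 0} → ℝ) (i : {j : Fin m // β j ≠ 0}) :
    (C *ᵥ extendZero β u) i = ((C.submatrix Subtype.val Subtype.val :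
      Matrix {j : Fin m // β j ≠ 0} {j : Fin m // β j ≠ 0} ℝ) *ᵥ u) i := by
  rw [mulVec, dotProduct_extendZero]
  rfl

lemma extendZero_quadForm (C : Matrix (Fin m) (Fin m) ℝ) (β : Fin m → ℝ)
    (u : {j : Fin m // β j ≠ 0} → ℝ) :
    extendZero β u ⬝ᵥ C *ᵥ extendZero β u = u ⬝ᵥ (C.submatrix Subtype.val Subtype.val :
      Matrix {j : Fin m // β j ≠ 0} {j : Fin m // β j ≠ 0} ℝ) *ᵥ u := by
  rw [dotProduct_comm, dotProduct_extendZero, dotProduct_comm]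
  congr 1
  exact funext fun i => mulVec_extendZero C β u i

/-- The block of `C` that belongs to the support of `β`. -/
def supportBlock (C : Matrix (Fin m) (Fin m) ℝ) (β : Fin m → ℝ) :
    Matrix {j : Fin m // β j ≠ 0} {j : Fin m // β j ≠ 0} ℝ :=
  C.submatrix Subtype.val Subtype.val

lemma posDef_supportBlock {C : Matrix (Fin m) (Fin m) ℝ} (hC : C.PosDef) (β : Fin m → ℝ) :
    (supportBlock C β).PosDef :=
  hC.submatrix Subtype.val_injective

/-- The slopes, on the support of `β`, of the minimiser of `limitQuad a C - z`. -/
noncomputable def oracleSlope (a : Fin K → ℝ) (C : Matrix (Fin m) (Fin m) ℝ) (β : Fin m → ℝ)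
    (z : Fin K ⊕ Fin m → ℝ) : {j : Fin m // β j ≠ 0} → ℝ :=
  ((∑ k, a k)⁻¹ • (supportBlock C β)⁻¹) *ᵥ fun i => z (.inr i)

/-- The minimiser of `limitQuad a C - z` among the parameters whose slopes vanish outside the support
of `β`. -/
noncomputable def oracleParam (a : Fin K → ℝ) (C : Matrix (Fin m) (Fin m) ℝ) (β : Fin m → ℝ)
    (z : Fin K ⊕ Fin m → ℝ) : Fin K ⊕ Fin m → ℝ :=
  Sum.elim (fun k => z (.inl k) / a k) (extendZero β (oracleSlope a C β z))

lemma oracleParam_inr_of_eq_zero (a : Fin K → ℝ) (C : Matrix (Fin m) (Fin m) ℝ) {β : Fin m → ℝ}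
    (z : Fin K ⊕ Fin m → ℝ) {j : Fin m} (hj : β j = 0) : oracleParam a C β z (.inr j) = 0 := by
  simp [oracleParam, extendZero, hj]

lemma oracleParam_inr (a : Fin K → ℝ) (C : Matrix (Fin m) (Fin m) ℝ) {β : Fin m → ℝ}
    (z : Fin K ⊕ Fin m → ℝ) (j : {j : Fin m // β j ≠ 0}) :
    oracleParam a C β z (.inr j) = oracleSlope a C β z j := by
  rw [oracleParam, Sum.elim_inr, extendZero, dif_pos j.2]

/-- Completing the square at the oracle parameter. -/
lemma limitQuad_oracleParam_add {a : Fin K → ℝ} (ha : ∀ k, 0 < a k) (ha' : 0 < ∑ k, a k)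
    {C : Matrix (Fin m) (Fin m) ℝ} (hC : C.PosDef) {β : Fin m → ℝ} (z η : Fin K ⊕ Fin m → ℝ)
    (hη : ∀ j, β j = 0 → η (.inr j) = 0) :
    limitQuad a C (oracleParam a C β z + η) - z ⬝ᵥ (oracleParam a C β z + η) =
      limitQuad a C (oracleParam a C β z) - z ⬝ᵥ oracleParam a C β z + limitQuad a C η := by
  have hnormal : ∀ j, β j ≠ 0 →
      (∑ k, a k) * (C *ᵥ (oracleParam a C β z ∘ Sum.inr)) j = z (.inr j) := fun j hj => by
    have h1 : oracleParam a C β z ∘ Sum.inr = extendZero β (oracleSlope a C β z) := rfl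
    have h2 := mulVec_extendZero C β (oracleSlope a C β z) ⟨j, hj⟩
    have hdet : IsUnit (supportBlock C β).det :=
      (Matrix.isUnit_iff_isUnit_det _).1 (posDef_supportBlock hC β).isUnit
    rw [h1, h2, ← supportBlock, oracleSlope, mulVec_mulVec, Matrix.mul_smul,
      Matrix.mul_nonsing_inv _ hdet, smul_mulVec, one_mulVec, Pi.smul_apply, smul_eq_mul,
      mul_inv_cancel_left₀ ha'.ne']
  have hlin : ∑ k, a k * oracleParam a C β z (.inl k) * η (.inl k) +
      (∑ k, a k) * ((C *ᵥ (oracleParam a C β z ∘ Sum.inr)) ⬝ᵥ (η ∘ Sum.inr)) = z ⬝ᵥ η := by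
    rw [dotProduct, dotProduct, Fintype.sum_sum_type, Finset.mul_sum]
    congr 1
    · refine Finset.sum_congr rfl fun k _ => ?_
      have := (ha k).ne'
      simp only [oracleParam, Sum.elim_inl]
      field_simp
    · refine Finset.sum_congr rfl fun j _ => ?_
      rw [Function.comp, ← mul_assoc]
      by_cases hj : β j = 0
      · rw [hη j hj, mul_zero, mul_zero]
      · rw [hnormal j hj]
  rw [limitQuad_add hC.1, dotProduct_add, ← hlin]
  ring

lemma quad_smul_inv {κ : Type*} [Fintype κ] [DecidableEq κ] {D : Matrix κ κ ℝ} (hD : D.PosDef)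
    (c : ℝ) (s : κ → ℝ) :
    ((c • D⁻¹) *ᵥ s) ⬝ᵥ D *ᵥ ((c • D⁻¹) *ᵥ s) = s ⬝ᵥ (c ^ 2 • D⁻¹) *ᵥ s := by
  have hdet : IsUnit D.det := (Matrix.isUnit_iff_isUnit_det _).1 hD.isUnit
  rw [mulVec_mulVec, Matrix.mul_smul, Matrix.mul_nonsing_inv _ hdet]
  simp only [smul_mulVec, one_mulVec, smul_dotProduct, dotProduct_smul, smul_eq_mul]
  rw [dotProduct_comm]
  ring

end Oracle

/-! ### Asymptotic law of the oracle slopes -/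

section OracleLaw

variable {Ω : Type*} [MeasurableSpace Ω] {P : Measure Ω} [IsProbabilityMeasure P] {ν : Measure ℝ}
  {ε : ℕ → Ω → ℝ} {m K : ℕ} {p : ℝ} {τ b : Fin K → ℝ} {x : ℕ → Fin m → ℝ} {β : Fin m → ℝ}
  {C : Matrix (Fin m) (Fin m) ℝ}

lemma oracleSlope_score (a : Fin K → ℝ) (C : Matrix (Fin m) (Fin m) ℝ) (β : Fin m → ℝ) (p : ℝ)
    (τ : Fin K → ℝ) (x : ℕ → Fin m → ℝ) (b : Fin K → ℝ) (T : ℕ) (e : ℕ → ℝ) :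
    oracleSlope a C β (score p τ x b T e) =
      ∑ t ∈ Finset.range T, (totalPhi p τ b (e t) / √(T : ℝ)) •
        (((∑ k, a k)⁻¹ • (supportBlock C β)⁻¹) *ᵥ fun i => x t i) := by
  have h1 : (fun i : {j : Fin m // β j ≠ 0} => score p τ x b T e (.inr i)) =
      ∑ t ∈ Finset.range T, (totalPhi p τ b (e t) / √(T : ℝ)) • fun i : {j : Fin m // β j ≠ 0} => x t i := by
    ext i
    rw [score, Sum.elim_inr, Finset.sum_apply]
    refine Finset.sum_congr rfl fun t _ => ?_
    rw [Pi.smul_apply, smul_eq_mul]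
    ring
  rw [oracleSlope, h1, mulVec_sum]
  simp only [mulVec_smul]

/-- The oracle slopes are a weighted sum of centred i.i.d. variables, hence asymptotically normal. -/
lemma tendstoInDistribution_oracleSlope (hlaw : ∀ t, HasLaw (ε t) ν P) (hindep : iIndepFun ε P)
    (hp : 1 < p) (hp2 : p ≤ 2) (hτ0 : ∀ k, 0 < τ k) (hτ1 : ∀ k, τ k < 1)
    (hmoment : Integrable (fun s : ℝ => |s| ^ (2 * (p - 1))) ν)
    (h0 : ∀ k, ∫ s, phi p (τ k) (s - b k) ∂ν = 0) (hC : C.PosDef)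
    (hdesign : Tendsto (fun T : ℕ => (T : ℝ)⁻¹ • ((designMatrix x T)ᵀ * designMatrix x T))
      atTop (𝓝 C)) :
    TendstoInDistribution (fun (T : ℕ) ω => WithLp.toLp 2
        (oracleSlope (fun k => ∫ s, psi p (τ k) (s - b k) ∂ν) C β
          (score p τ x b T fun t => ε t ω))) atTop id (fun _ => P)
      (multivariateGaussian 0 (oracleCovariance p τ ν b C β)) := by
  have : IsProbabilityMeasure ν := (hlaw 0).isProbabilityMeasure_iff.1 inferInstance
  have hCA := posDef_supportBlock hC β
  set A : ℝ := ∑ k, ∫ s, psi p (τ k) (s - b k) ∂ν with hA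
  have hsym : (A⁻¹ • (supportBlock C β)⁻¹)ᵀ = A⁻¹ • (supportBlock C β)⁻¹ := by
    have : (supportBlock C β)⁻¹ᵀ = (supportBlock C β)⁻¹ := by simpa using hCA.inv.1.eq
    rw [transpose_smul, this]
  have hcov : (∫ s, totalPhi p τ b s ^ 2 ∂ν) • (A⁻¹ ^ 2 • (supportBlock C β)⁻¹) =
      oracleCovariance p τ ν b C β := by
    rw [smul_smul, integral_totalPhi_sq hp hp2 hτ0 hτ1 hmoment, inv_pow, ← div_eq_mul_inv]
    rfl
  rw [← hcov]
  simp_rw [oracleSlope_score, ← hA]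
  refine tendstoInDistribution_weighted_sum hlaw hindep (measurable_totalPhi hp hτ0 hτ1)
    (memLp_totalPhi hp hp2 hτ0 hτ1 hmoment)
    (integral_totalPhi_eq_zero hp hp2 hτ0 hτ1 hmoment h0)
    (hCA.inv.posSemidef.smul (sq_nonneg _)) fun s => ?_
  have h1 := tendsto_quad_design hdesign
    (extendZero β ((A⁻¹ • (supportBlock C β)⁻¹) *ᵥ s))
  rw [extendZero_quadForm] at h1
  rw [← quad_smul_inv hCA]
  refine h1.congr fun T => ?_
  congr 1
  refine Finset.sum_congr rfl fun t _ => ?_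
  rw [dotProduct_extendZero, dotProduct_mulVec, ← mulVec_transpose, hsym, dotProduct_comm]

end OracleLaw

/-! ### Estimators in local coordinates -/

section Estimators

variable {m K : ℕ} {p : ℝ} {τ : Fin K → ℝ} {x : ℕ → Fin m → ℝ} {b : Fin K → ℝ} {β : Fin m → ℝ}
  {y e : ℕ → ℝ} {T : ℕ}

/-- The local parameter of `(b', β')` around `(b, β)` at scale `s`. -/
def localParam (s : ℝ) (b b' : Fin K → ℝ) (β β' : Fin m → ℝ) : Fin K ⊕ Fin m → ℝ :=
  Sum.elim (fun k => s * (b' k - b k)) fun j => s * (β' j - β j)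

lemma add_localParam_inl_div {s : ℝ} (hs : s ≠ 0) (b b' : Fin K → ℝ) (β β' : Fin m → ℝ)
    (k : Fin K) : b k + localParam s b b' β β' (.inl k) / s = b' k := by
  simp only [localParam, Sum.elim_inl]; field_simp; ring

lemma add_localParam_inr_div {s : ℝ} (hs : s ≠ 0) (b b' : Fin K → ℝ) (β β' : Fin m → ℝ)
    (j : Fin m) : β j + localParam s b b' β β' (.inr j) / s = β' j := by
  simp only [localParam, Sum.elim_inr]; field_simp; ring

lemma objective_sub_localParam (hy : ∀ t, y t = x t ⬝ᵥ β + e t) (hT : √(T : ℝ) ≠ 0)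
    (b' : Fin K → ℝ) (β' : Fin m → ℝ) :
    objective p τ x y T b' β' - objective p τ x y T b β =
      remSum p τ x b T e (localParam √(T : ℝ) b b' β β') -
        score p τ x b T e ⬝ᵥ localParam √(T : ℝ) b b' β β' := by
  rw [← objective_sub p τ x b β y e hy]
  simp only [add_localParam_inl_div hT, add_localParam_inr_div hT]

lemma IsEstimate.criterion_le (hy : ∀ t, y t = x t ⬝ᵥ β + e t) (hT : √(T : ℝ) ≠ 0)
    {b' : Fin K → ℝ} {β' : Fin m → ℝ} (h : IsEstimate p τ x y T b' β') :
    remSum p τ x b T e (localParam √(T : ℝ) b b' β β') -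
      score p τ x b T e ⬝ᵥ localParam √(T : ℝ) b b' β β' ≤ 0 := by
  rw [← objective_sub_localParam hy hT]
  linarith [h b β]

lemma IsAdaptiveEstimate.criterion_le (hy : ∀ t, y t = x t ⬝ᵥ β + e t) (hT : √(T : ℝ) ≠ 0)
    {lam : ℝ} {w : Fin m → ℝ} {b' : Fin K → ℝ} {β' : Fin m → ℝ}
    (h : IsAdaptiveEstimate p τ x y T lam w b' β') (θ : Fin K ⊕ Fin m → ℝ)
    (hθ : ∀ j, w j = 0 → β j + θ (.inr j) / √(T : ℝ) = 0) :
    remSum p τ x b T e (localParam √(T : ℝ) b b' β β') -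
        score p τ x b T e ⬝ᵥ localParam √(T : ℝ) b b' β β' +
        penLocal lam w β √(T : ℝ) (localParam √(T : ℝ) b b' β β') ≤
      remSum p τ x b T e θ - score p τ x b T e ⬝ᵥ θ + penLocal lam w β √(T : ℝ) θ := by
  rw [← objective_sub_localParam hy hT, ← objective_sub p τ x b β y e hy]
  have h1 := h.2 (fun k => b k + θ (.inl k) / √(T : ℝ)) _ hθ
  simp only [penLocal, add_localParam_inr_div hT]
  linarith

end Estimators

/-! ### Probabilistic behaviour of the estimators -/

section Asymptotics

variable {Ω : Type*} [MeasurableSpace Ω] {P : Measure Ω}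
  {m K : ℕ} {p : ℝ} {τ : Fin K → ℝ} {x : ℕ → Fin m → ℝ} {b : Fin K → ℝ} {β : Fin m → ℝ}
  {y ε : ℕ → Ω → ℝ} {a : Fin K → ℝ} {C : Matrix (Fin m) (Fin m) ℝ}
  {b_clp : ℕ → Ω → Fin K → ℝ} {β_clp : ℕ → Ω → Fin m → ℝ}
  {b_Aclp : ℕ → Ω → Fin K → ℝ} {β_Aclp : ℕ → Ω → Fin m → ℝ}

lemma remSum_zero (p : ℝ) (τ : Fin K → ℝ) (x : ℕ → Fin m → ℝ) (b : Fin K → ℝ) (T : ℕ)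
    (e : ℕ → ℝ) : remSum p τ x b T e 0 = 0 := by
  simp [remSum, shift]

/-- The unpenalised estimator converges at rate `√T`. -/
lemma exists_eventually_measure_pilot_le (hK : 0 < K) (hp : 1 < p) (hτ0 : ∀ k, 0 < τ k)
    (hτ1 : ∀ k, τ k < 1) (hy : ∀ t ω, y t ω = x t ⬝ᵥ β + ε t ω) (ha : ∀ k, 0 < a k)
    (hC : C.PosDef)
    (hQ : ∀ R ρ : ℝ, 0 ≤ R → 0 < ρ → Tendsto (fun T : ℕ => P {ω | ∃ θ, ‖θ‖ ≤ R ∧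
      ρ < |remSum p τ x b T (fun t => ε t ω) θ - limitQuad a C θ|}) atTop (𝓝 0))
    (hZ : ∀ η : ℝ, 0 < η → ∃ M : ℝ, 0 < M ∧ ∀ᶠ T : ℕ in atTop,
      P {ω | M < ‖score p τ x b T (fun t => ε t ω)‖} ≤ ENNReal.ofReal η)
    (hclp : ∀ᶠ T in atTop, ∀ᵐ ω ∂P,
      IsEstimate p τ x (fun t => y t ω) T (b_clp T ω) (β_clp T ω)) {η : ℝ} (hη : 0 < η) :
    ∃ r : ℝ, 0 < r ∧ ∀ᶠ T : ℕ in atTop,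
      P {ω | ¬∀ j, √(T : ℝ) * |β_clp T ω j - β j| ≤ r} ≤ ENNReal.ofReal η := by
  obtain ⟨c, hc, hq⟩ := exists_mul_norm_sq_le_limitQuad hK ha hC
  obtain ⟨M, hM, hZM⟩ := hZ (η / 2) (by positivity)
  obtain ⟨r, hr, hrM⟩ := exists_radius hc
    (by positivity : 0 ≤ (Fintype.card (Fin K ⊕ Fin m) : ℝ) * M)
  refine ⟨r, hr, ?_⟩
  have hQr := (hQ r 1 hr.le one_pos).eventually
    (ge_mem_nhds (ENNReal.ofReal_pos.2 (by positivity : 0 < η / 2)))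
  filter_upwards [hZM, hQr, hclp, eventually_gt_atTop 0] with T h1 h2 h3 hT
  have hs : 0 < √(T : ℝ) := Real.sqrt_pos.2 (by exact_mod_cast hT)
  rw [ae_iff] at h3
  calc _ ≤ P ({ω | M < ‖score p τ x b T (fun t => ε t ω)‖} ∪ {ω | ∃ θ, ‖θ‖ ≤ r ∧
          1 < |remSum p τ x b T (fun t => ε t ω) θ - limitQuad a C θ|} ∪
          {ω | ¬IsEstimate p τ x (fun t => y t ω) T (b_clp T ω) (β_clp T ω)}) :=
        measure_mono fun ω hω => ?_
    _ ≤ ENNReal.ofReal (η / 2) + ENNReal.ofReal (η / 2) + 0 :=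
        (measure_union_le _ _).trans
          (add_le_add ((measure_union_le _ _).trans (add_le_add h1 h2)) h3.le)
    _ = ENNReal.ofReal η := by
        rw [add_zero, ← ENNReal.ofReal_add (by positivity) (by positivity), add_halves]
  by_contra hnot
  simp only [Set.mem_union, Set.mem_ofPred_eq, not_or, not_lt, not_not, not_exists, not_and] at hnot
  obtain ⟨⟨hz, hQω⟩, hest⟩ := hnot
  refine hω fun j => ?_
  have h4 := hest.criterion_le (b := b) (β := β) (e := fun t => ε t ω) (fun t => hy t ω) hs.ne'
  have h5 := norm_le_of_criterion_le (pen := fun _ => 0) (convexOn_remSum hp hτ0 hτ1 x b T _)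
    (remSum_zero p τ x b T _) hq hz hr hrM hQω (convexOn_const 0 convex_univ) rfl
    (fun θ => by simp) (by simpa using h4)
  have h6 := (norm_le_pi_norm _ (Sum.inr j)).trans h5
  rwa [localParam, Sum.elim_inr, Real.norm_eq_abs, abs_mul, abs_of_pos hs] at h6

/-- With probability tending to one the adaptive estimator has the right support and is close to the
oracle parameter. -/
lemma tendsto_measure_adaptive (hK : 0 < K) (hp : 1 < p) (hp2 : p ≤ 2) (hτ0 : ∀ k, 0 < τ k)
    (hτ1 : ∀ k, τ k < 1) (hy : ∀ t ω, y t ω = x t ⬝ᵥ β + ε t ω) (ha : ∀ k, 0 < a k)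
    (hC : C.PosDef)
    (hQ : ∀ R ρ : ℝ, 0 ≤ R → 0 < ρ → Tendsto (fun T : ℕ => P {ω | ∃ θ, ‖θ‖ ≤ R ∧
      ρ < |remSum p τ x b T (fun t => ε t ω) θ - limitQuad a C θ|}) atTop (𝓝 0))
    (hZ : ∀ η : ℝ, 0 < η → ∃ M : ℝ, 0 < M ∧ ∀ᶠ T : ℕ in atTop,
      P {ω | M < ‖score p τ x b T (fun t => ε t ω)‖} ≤ ENNReal.ofReal η)
    {lam : ℕ → ℝ} (hlam1 : Tendsto (fun T : ℕ => lam T / √(T : ℝ)) atTop (𝓝 0))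
    (hlam2 : Tendsto (fun T : ℕ => lam T * (T : ℝ) ^ ((p - 2) / 2)) atTop atTop)
    (hclp : ∀ᶠ T in atTop, ∀ᵐ ω ∂P,
      IsEstimate p τ x (fun t => y t ω) T (b_clp T ω) (β_clp T ω))
    (hAclp : ∀ᶠ T in atTop, ∀ᵐ ω ∂P,
      IsAdaptiveEstimate p τ x (fun t => y t ω) T (lam T) (β_clp T ω) (b_Aclp T ω) (β_Aclp T ω))
    {δ : ℝ} (hδ : 0 < δ) :
    Tendsto (fun T : ℕ => P {ω | ¬((∀ j, β_Aclp T ω j ≠ 0 ↔ β j ≠ 0) ∧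
      ‖localParam √(T : ℝ) b (b_Aclp T ω) β (β_Aclp T ω) -
        oracleParam a C β (score p τ x b T fun t => ε t ω)‖ ≤ δ)}) atTop (𝓝 0) := by
  obtain ⟨c, hc, hq⟩ := exists_mul_norm_sq_le_limitQuad hK ha hC
  have : Nonempty (Fin K) := ⟨⟨0, hK⟩⟩
  have ha' : 0 < ∑ k, a k := Finset.sum_pos (fun k _ => ha k) Finset.univ_nonempty
  -- twice `d` bounds the nonzero coefficients from below
  obtain ⟨d, hd, hβd⟩ : ∃ d : ℝ, 0 < d ∧ ∀ j, β j ≠ 0 → 2 * d ≤ |β j| := by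
    have h1 : ∀ᶠ d : ℝ in 𝓝[>] 0, ∀ j, β j ≠ 0 → 2 * d ≤ |β j| := by
      refine eventually_all.2 fun j => ?_
      by_cases hj : β j = 0
      · exact Eventually.of_forall fun d h => absurd hj h
      · have h2 : ∀ᶠ d : ℝ in 𝓝 0, 2 * d < |β j| :=
          (continuous_const.mul continuous_id).continuousAt.eventually
            (gt_mem_nhds (by simpa using hj))
        filter_upwards [h2.filter_mono nhdsWithin_le_nhds] with d hd _
        exact hd.le
    obtain ⟨d, h2, h3⟩ := (h1.and self_mem_nhdsWithin).exists
    exact ⟨d, h3, h2⟩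
  -- the penalty level tends to infinity since `p ≤ 2`
  have hlam0 : ∀ᶠ T : ℕ in atTop, 0 ≤ lam T := by
    filter_upwards [hlam2.eventually_ge_atTop 0, eventually_gt_atTop 0] with T h hT
    have : 0 < (T : ℝ) ^ ((p - 2) / 2) := Real.rpow_pos_of_pos (by exact_mod_cast hT) _
    exact nonneg_of_mul_nonneg_left h this
  have hlams : Tendsto (fun T : ℕ => lam T * √(T : ℝ)) atTop atTop := by
    refine tendsto_atTop_mono' _ ?_ hlam2
    filter_upwards [hlam0, eventually_ge_atTop 1] with T h hT
    have hT' : (1 : ℝ) ≤ T := by exact_mod_cast hT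
    refine mul_le_mul_of_nonneg_left ?_ h
    exact (Real.rpow_le_one_of_one_le_of_nonpos hT' (by linarith)).trans
      (Real.one_le_sqrt.2 hT')
  have hsqrt : Tendsto (fun T : ℕ => √(T : ℝ)) atTop atTop :=
    Real.tendsto_sqrt_atTop.comp tendsto_natCast_atTop_atTop
  rw [ENNReal.tendsto_nhds_zero]
  intro η₀ hη₀
  obtain ⟨η, hη, hηη₀⟩ : ∃ η : ℝ, 0 < η ∧ ENNReal.ofReal (3 * η) ≤ η₀ := by
    obtain ⟨e, he, hlt⟩ := ENNReal.lt_iff_exists_nnreal_btwn.1 hη₀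
    have he' : (0 : ℝ) < e := by exact_mod_cast he
    refine ⟨e / 3, by positivity, ?_⟩
    rw [mul_div_cancel₀ _ (by norm_num : (3 : ℝ) ≠ 0), ENNReal.ofReal_coe_nnreal]
    exact hlt.le
  obtain ⟨M, hM, hZM⟩ := hZ η hη
  obtain ⟨r₁, hr₁, hpilot⟩ :=
    exists_eventually_measure_pilot_le hK hp hτ0 hτ1 hy ha hC hQ hZ hclp hη
  obtain ⟨r, hr, hrM⟩ := exists_radius hc
    (by positivity : 0 ≤ (Fintype.card (Fin K ⊕ Fin m) : ℝ) * M)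
  obtain ⟨B, hB⟩ : ∃ B : ℝ, ∀ θ, ‖θ‖ ≤ r + 2 → limitQuad a C θ + 1 ≤ B := by
    obtain ⟨B, hB⟩ := ((isCompact_closedBall (0 : Fin K ⊕ Fin m → ℝ) (r + 2)).image
      (continuous_limitQuad a C)).bddAbove
    refine ⟨B + 1, fun θ hθ => ?_⟩
    have := hB (Set.mem_image_of_mem _ (by simpa using hθ : θ ∈ Metric.closedBall 0 (r + 2)))
    linarith
  set ρ : ℝ := min 1 (c * δ ^ 2 / 4) with hρ
  have hρ0 : 0 < ρ := lt_min one_pos (by positivity)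
  have hQr := (hQ (r + 2) ρ (by positivity) hρ0).eventually
    (ge_mem_nhds (ENNReal.ofReal_pos.2 hη))
  have hsmall : Tendsto (fun T : ℕ => lam T / √(T : ℝ) * (m / d ^ 2)) atTop (𝓝 0) := by
    simpa using hlam1.mul_const ((m : ℝ) / d ^ 2)
  have hsmallρ : Tendsto (fun T : ℕ => lam T / √(T : ℝ) * (m / d ^ 2) * r) atTop (𝓝 0) := by
    simpa using hsmall.mul_const r
  filter_upwards [hZM, hQr, hpilot, hAclp, eventually_gt_atTop 0, hlam0,
    hlams.eventually_gt_atTop ((2 * B + M) * r₁ ^ 2), hsmall.eventually (ge_mem_nhds one_pos),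
    hsmallρ.eventually (ge_mem_nhds hρ0),
    (hsqrt.const_mul_atTop hd).eventually_ge_atTop r₁,
    (hsqrt.const_mul_atTop (by positivity : 0 < 2 * d)).eventually_gt_atTop r]
    with T h1 h2 h3 h4 hT hlamT hlarge hsm hsmρ hsd hsr
  have hs : 0 < √(T : ℝ) := Real.sqrt_pos.2 (by exact_mod_cast hT)
  rw [ae_iff] at h4
  calc _ ≤ P ({ω | M < ‖score p τ x b T (fun t => ε t ω)‖} ∪ {ω | ∃ θ, ‖θ‖ ≤ r + 2 ∧
          ρ < |remSum p τ x b T (fun t => ε t ω) θ - limitQuad a C θ|} ∪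
          {ω | ¬∀ j, √(T : ℝ) * |β_clp T ω j - β j| ≤ r₁} ∪
          {ω | ¬IsAdaptiveEstimate p τ x (fun t => y t ω) T (lam T) (β_clp T ω) (b_Aclp T ω)
            (β_Aclp T ω)}) := measure_mono fun ω hω => ?_
    _ ≤ ENNReal.ofReal η + ENNReal.ofReal η + ENNReal.ofReal η + 0 :=
        (measure_union_le _ _).trans (add_le_add ((measure_union_le _ _).trans
          (add_le_add ((measure_union_le _ _).trans (add_le_add h1 h2)) h3)) h4.le)
    _ = ENNReal.ofReal (3 * η) := by
        rw [add_zero, ← ENNReal.ofReal_add hη.le hη.le,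
          ← ENNReal.ofReal_add (by positivity) hη.le]
        congr 1; ring
    _ ≤ η₀ := hηη₀
  by_contra hnot
  simp only [Set.mem_union, Set.mem_ofPred_eq, not_or, not_lt, not_not, not_exists, not_and] at hnot
  obtain ⟨⟨⟨hz, hQω⟩, hw⟩, hest⟩ := hnot
  have hfeas : ∀ j, β_clp T ω j = 0 →
      β j + localParam √(T : ℝ) b (b_Aclp T ω) β (β_Aclp T ω) (.inr j) / √(T : ℝ) = 0 :=
    fun j hj => by rw [add_localParam_inr_div hs.ne']; exact hest.1 j hj
  obtain ⟨hsel, hclose⟩ := adaptive_minimizer (convexOn_remSum hp hτ0 hτ1 x b T _)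
    (remSum_nonneg hp hτ0 hτ1 x b T _) (remSum_zero p τ x b T _) hc hq (by simp [limitQuad]) hz hr
    hrM (min_le_left _ _) hQω hB hs hlamT hd hr₁ hβd hw hsd hsr hlarge hsm hsmρ hfeas
    (hest.criterion_le (fun t => hy t ω) hs.ne')
    (fun j hj => oracleParam_inr_of_eq_zero a C (score p τ x b T fun t => ε t ω) hj)
    (fun η hη => limitQuad_oracleParam_add ha ha' hC _ η hη)
  simp only [add_localParam_inr_div hs.ne'] at hsel
  refine hω ⟨hsel, ?_⟩
  have h5 : 4 * ρ ≤ c * δ ^ 2 := by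
    have := min_le_right 1 (c * δ ^ 2 / 4)
    linarith
  exact (sq_le_sq₀ (norm_nonneg _) hδ.le).1 (le_of_mul_le_mul_left (hclose.trans h5) hc)

end Asymptotics

end CLpQR

open CLpQR
theorem theorem3p1
    {Ω : Type*} [MeasurableSpace Ω] (P : Measure Ω) [IsProbabilityMeasure P]
    {m K : ℕ} (hK : 0 < K)
    (p : ℝ) (hp1 : 1 < p) (hp2 : p ≤ 2)
    -- the weights
    (τ : Fin K → ℝ) (hτ0 : ∀ k, 0 < τ k) (hτ1 : ∀ k, τ k < 1) (hτ : StrictMono τ)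
    -- the linear model with i.i.d. errors of law `ν`
    (x : ℕ → Fin m → ℝ) (βstar : Fin m → ℝ) (ν : Measure ℝ)
    (ε : ℕ → Ω → ℝ) (hε_law : ∀ t, HasLaw (ε t) ν P) (hε_indep : iIndepFun ε P)
    (y : ℕ → Ω → ℝ) (hy : ∀ t ω, y t ω = x t ⬝ᵥ βstar + ε t ω)
    (bstar : Fin K → ℝ) (hb : ∀ k, CLpQR.IsLpQuantile p (τ k) ν (bstar k))
    -- the predictor is (asymptotically) centred
    (hcenter : Tendsto (fun T : ℕ => (T : ℝ)⁻¹ • ∑ t ∈ Finset.range T, x t) atTop (𝓝 0))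
    -- the limiting design matrix
    (C : Matrix (Fin m) (Fin m) ℝ) (hC : C.PosDef)
    (hdesign : Tendsto
      (fun T : ℕ => (T : ℝ)⁻¹ • ((CLpQR.designMatrix x T)ᵀ * CLpQR.designMatrix x T)) atTop (𝓝 C))
    -- `E |ε|^(2(p-1)) < ∞`
    (hmoment : Integrable (fun s : ℝ => |s| ^ (2 * (p - 1))) ν)
    -- `E |ε - b|^(p-2) < ∞` for `b` near the `L^p`-quantiles (with `0^(p-2) = ∞` when `p < 2`)
    (hneg : ∃ δ : ℝ, 0 < δ ∧ ∀ k, ∀ b ∈ Metric.ball (bstar k) δ,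
      ∫⁻ s, ENNReal.ofReal |s - b| ^ (p - 2) ∂ν < ⊤)
    -- for `p = 2`: no atom at a kink of the derivative of the loss
    (hatom : p = 2 → ∀ k, τ k ≠ 1 / 2 → ν {bstar k} = 0)
    -- the penalty level
    (lam : ℕ → ℝ) (hlam1 : Tendsto (fun T : ℕ => lam T / √(T : ℝ)) atTop (𝓝 0))
    (hlam2 : Tendsto (fun T : ℕ => lam T * (T : ℝ) ^ ((p - 2) / 2)) atTop atTop)
    -- the unpenalised and the adaptively penalised estimators
    (b_clp : ℕ → Ω → Fin K → ℝ) (β_clp : ℕ → Ω → Fin m → ℝ)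
    (hb_clp_meas : ∀ T, AEMeasurable (b_clp T) P) (hβ_clp_meas : ∀ T, AEMeasurable (β_clp T) P)
    (hclp : ∀ᶠ T in atTop, ∀ᵐ ω ∂P,
      CLpQR.IsEstimate p τ x (fun t => y t ω) T (b_clp T ω) (β_clp T ω))
    (b_Aclp : ℕ → Ω → Fin K → ℝ) (β_Aclp : ℕ → Ω → Fin m → ℝ)
    (hb_Aclp_meas : ∀ T, AEMeasurable (b_Aclp T) P)
    (hβ_Aclp_meas : ∀ T, AEMeasurable (β_Aclp T) P)
    (hAclp : ∀ᶠ T in atTop, ∀ᵐ ω ∂P,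
      CLpQR.IsAdaptiveEstimate p τ x (fun t => y t ω) T (lam T) (β_clp T ω)
        (b_Aclp T ω) (β_Aclp T ω)) :
    Tendsto (fun T : ℕ => P {ω | {j | β_Aclp T ω j ≠ 0} = {j | βstar j ≠ 0}}) atTop (𝓝 1) ∧
    TendstoInDistribution
      (fun (T : ℕ) (ω : Ω) => WithLp.toLp 2
        (fun j : {j : Fin m // βstar j ≠ 0} => √(T : ℝ) * (β_Aclp T ω j - βstar j)))
      atTop id (fun _ => P)
      (multivariateGaussian 0 (CLpQR.oracleCovariance p τ ν bstar C βstar)) := by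
  have : IsProbabilityMeasure ν := (hε_law 0).isProbabilityMeasure_iff.1 inferInstance
  obtain ⟨δ₀, hδ₀, hball⟩ := hneg
  have hneg' : ∀ k, ∫⁻ s, ENNReal.ofReal |s - bstar k| ^ (p - 2) ∂ν < ⊤ := fun k =>
    hball k _ (Metric.mem_ball_self hδ₀)
  have hint : ∀ k, Integrable (fun s => |s - bstar k| ^ (p - 2)) ν := fun k =>
    integrable_abs_sub_rpow hp2 (hneg' k)
  have hne : ∀ k, ∀ᵐ s ∂ν, s ≠ bstar k ∨ (p = 2 ∧ τ k = 1 / 2) := fun k =>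
    ae_ne_or hp2 (hneg' k) fun h2 => hatom h2 k
  have h0 : ∀ k, ∫ s, phi p (τ k) (s - bstar k) ∂ν = 0 := fun k =>
    integral_phi_eq_zero hp1 hp2 (hτ0 k).le (hτ1 k).le hmoment (hint k) (hne k) (hb k)
  set a : Fin K → ℝ := fun k => ∫ s, psi p (τ k) (s - bstar k) ∂ν with ha_def
  have ha : ∀ k, 0 < a k := fun k => integral_psi_pos hp1 (hτ0 k) (hτ1 k) (hint k) (hne k)
  have key : ∀ δ : ℝ, 0 < δ → Tendsto (fun T : ℕ =>
      P {ω | ¬((∀ j, β_Aclp T ω j ≠ 0 ↔ βstar j ≠ 0) ∧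
        ‖localParam √(T : ℝ) bstar (b_Aclp T ω) βstar (β_Aclp T ω) -
          oracleParam a C βstar (score p τ x bstar T fun t => ε t ω)‖ ≤ δ)}) atTop (𝓝 0) :=
    fun δ hδ => tendsto_measure_adaptive hK hp1 hp2 hτ0 hτ1 hy ha hC
      (fun R ρ hR hρ => tendsto_measure_remSum hε_law hε_indep hK hp1 hp2 hτ0 hτ1 hint hne hcenter
        hdesign hR hρ)
      (fun η hη => exists_eventually_measure_score_le hε_law hε_indep hp1 hp2 hτ0 hτ1 hmoment h0
        hdesign hη) hlam1 hlam2 hclp hAclp hδ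
  refine ⟨?_, ?_⟩
  · have h1 := ENNReal.Tendsto.sub tendsto_const_nhds (key 1 one_pos)
      (Or.inl ENNReal.one_ne_top) (a := 1)
    rw [tsub_zero] at h1
    refine tendsto_of_tendsto_of_tendsto_of_le_of_le h1 tendsto_const_nhds (fun T => ?_)
      fun T => prob_le_one
    refine tsub_le_iff_right.2 ?_
    rw [← measure_univ (μ := P)]
    refine (measure_mono fun ω _ => ?_).trans (measure_union_le _ _)
    by_cases h : (∀ j, β_Aclp T ω j ≠ 0 ↔ βstar j ≠ 0)
    · exact Or.inl (Set.ext h)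
    · exact Or.inr fun h' => h h'.1
  · have hclt := tendstoInDistribution_oracleSlope (β := βstar) hε_law hε_indep hp1 hp2 hτ0 hτ1
      hmoment h0 hC hdesign
    refine tendstoInDistribution_of_tendstoInMeasure_sub _ _ hclt ?_ fun T => ?_
    · obtain ⟨L, hL, hLle⟩ : ∃ L : ℝ, 0 < L ∧ ∀ u : {j : Fin m // βstar j ≠ 0} → ℝ,
          ‖WithLp.toLp 2 u‖ ≤ L * ‖u‖ := by
        refine ⟨‖((PiLp.continuousLinearEquiv 2 ℝ
          fun _ : {j : Fin m // βstar j ≠ 0} => ℝ).symm.toContinuousLinearMap)‖ + 1,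
          by positivity, fun u => ?_⟩
        refine (((PiLp.continuousLinearEquiv 2 ℝ
          fun _ : {j : Fin m // βstar j ≠ 0} => ℝ).symm.toContinuousLinearMap).le_opNorm
            u).trans ?_
        gcongr
        linarith
      rw [tendstoInMeasure_iff_norm]
      intro δ hδ
      refine tendsto_of_tendsto_of_tendsto_of_le_of_le tendsto_const_nhds
        (key (δ / (2 * L)) (by positivity)) (fun _ => zero_le) fun T => measure_mono fun ω hω => ?_
      rintro ⟨-, hclose⟩
      simp only [Set.mem_ofPred_eq, Pi.sub_apply, Pi.zero_apply, sub_zero, ← WithLp.toLp_sub] at hω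
      have h2 := hω.trans (hLle _)
      have h3 : ‖(fun j : {j : Fin m // βstar j ≠ 0} =>
          √(T : ℝ) * (β_Aclp T ω j - βstar j)) -
          oracleSlope a C βstar (score p τ x bstar T fun t => ε t ω)‖ ≤ δ / (2 * L) := by
        refine (pi_norm_le_iff_of_nonneg (by positivity)).2 fun j => ?_
        refine le_trans (le_of_eq ?_) ((norm_le_pi_norm _ (Sum.inr (j : Fin m))).trans hclose)
        rw [Pi.sub_apply, Pi.sub_apply, oracleParam_inr]
        rfl
      have h4 : L * (δ / (2 * L)) = δ / 2 := by field_simp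
      have h5 := mul_le_mul_of_nonneg_left h3 hL.le
      linarith
    · refine (WithLp.measurable_toLp 2 _).comp_aemeasurable (aemeasurable_pi_lambda _ fun j => ?_)
      exact (((measurable_pi_apply (j : Fin m)).comp_aemeasurable
        (hβ_Aclp_meas T)).sub_const _).const_mul _
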